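/- Let $\alpha>0$ and $1<p<\infty$, let $p'$ be the conjugate exponent ($1/p+1/p'=1$), and let $dA$ be Lebesgue measure on $\mathbb{C}$. A weight is a nonnegative locally integrable function on $\mathbb{C}$. For $1<q<\infty$ and a nonnegative measurable function $v$ on $\mathbb{C}$, let $F^q_{\alpha,v}$ be the space of entire functions $f$ with $$\|f\|_{F^q_{\alpha,v}}:=\Big(\int_{\mathbb{C}}|f(z)|^q e^{-\frac{q\alpha}{2}|z|^2}v(z)\,dA(z)\Big)^{1/q}<\infty .$$ Let $w$ be a weight of class $A_p^{\mathrm{restricted}}$; that is, $w>0$ almost everywhere and, for some $t>0$, $$\sup_{z\in\mathbb{C}}\Big(\frac{1}{A(Q_t(z))}\int_{Q_t(z)}w\,dA\Big)\Big(\frac{1}{A(Q_t(z))}\int_{Q_t(z)}w^{-p'/p}\,dA\Big)^{p/p'}<\infty ,$$ where $Q_t(z)$ is the square with center $z$, side length $t$ and sides parallel to the coordinate axes. Put $w'=w^{-p'/p}$. Then for all $f\in F^p_{\alpha,w}$ and $g\in F^{p'}_{\alpha,w'}$ the integral $$\langle f,g\rangle_\alpha:=\int_{\mathbb{C}}f(z)\overline{g(z)}e^{-\alpha|z|^2}\,dA(z)$$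 converges absolutely, and the map $g\mapsto\langle\,\cdot\,,g\rangle_\alpha$ is a conjugate-linear bijection of $F^{p'}_{\alpha,w'}$ onto the dual space $(F^p_{\alpha,w})^*$ of bounded linear functionals, continuous with continuous inverse. In other words, every bounded linear functional on $F^p_{\alpha,w}$ has the form $\langle\,\cdot\,,g\rangle_\alpha$ for exactly one $g\in F^{p'}_{\alpha,w'}$, and its norm is comparable to $\|g\|_{F^{p'}_{\alpha,w'}}$ with constants that do not depend on $g$. -/

import Mathlib

open MeasureTheory
open scoped ENNReal ComplexConjugate

noncomputable section

namespace WeightedFock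

/-- A weight on `ℂ`: a nonnegative, locally integrable function. -/
structure IsWeight (w : ℂ → ℝ) : Prop where
  nonneg : ∀ z, 0 ≤ w z
  locallyIntegrable : LocallyIntegrable w volume

/-- The square `Q_t(z)` centered at `z` with side length `t` and sides parallel to the axes. -/
def square (t : ℝ) (z : ℂ) : Set ℂ :=
  {u | |u.re - z.re| ≤ t / 2 ∧ |u.im - z.im| ≤ t / 2}

/-- The constant `𝒞_{p,t}(w)`, as an extended nonnegative real number (`p'` is the conjugate
exponent of `p`, and `⨍⁻` is the average over the square). -/
def apConst (p t : ℝ) (w : ℂ → ℝ) : ℝ≥0∞ :=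
  ⨆ z : ℂ, (⨍⁻ u in square t z, ENNReal.ofReal (w u) ∂volume) *
    (⨍⁻ u in square t z, ENNReal.ofReal (w u ^ (-(p.conjExponent / p))) ∂volume) ^
      (p / p.conjExponent)

/-- The class `A_p^restricted` (for `1 < p < ∞`). -/
structure MemApRestricted (p : ℝ) (w : ℂ → ℝ) : Prop where
  isWeight : IsWeight w
  ae_pos : ∀ᵐ z ∂(volume : Measure ℂ), 0 < w z
  exists_const_lt_top : ∃ t : ℝ, 0 < t ∧ apConst p t w < ∞

/-- The measure `e^{-(pα/2)|z|²} w(z) dA(z)`, so that `L^p_{α,w}` is `L^p` of this measure. -/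
def fockMeasure (α p : ℝ) (w : ℂ → ℝ) : Measure ℂ :=
  volume.withDensity fun z => ENNReal.ofReal (Real.exp (-(p * α / 2) * ‖z‖ ^ 2) * w z)

/-- The entire functions that belong to `L^p_{α,w}`, as a linear subspace of `ℂ → ℂ`. -/
def fockSubmodule (α p : ℝ) (w : ℂ → ℝ) : Submodule ℂ (ℂ → ℂ) where
  carrier := {f | Differentiable ℂ f ∧ MemLp f (ENNReal.ofReal p) (fockMeasure α p w)}
  add_mem' hf hg := ⟨hf.1.add hg.1, hf.2.add hg.2⟩
  zero_mem' := ⟨differentiable_const 0, MemLp.zero⟩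
  smul_mem' c _ hf := ⟨hf.1.const_smul c, hf.2.const_smul c⟩

/-- The weighted Fock space `F^p_{α,w}`. It is a type of its own, so that its topology is the one
of its norm and not the topology of pointwise convergence inherited from `ℂ → ℂ`. -/
def FockSpace (α p : ℝ) (w : ℂ → ℝ) : Type := fockSubmodule α p w

namespace FockSpace

variable {α p : ℝ} {w : ℂ → ℝ}

instance : AddCommGroup (FockSpace α p w) :=
  inferInstanceAs (AddCommGroup (fockSubmodule α p w))

instance : Module ℂ (FockSpace α p w) :=
  inferInstanceAs (Module ℂ (fockSubmodule α p w))

instance : CoeFun (FockSpace α p w) fun _ => ℂ → ℂ := ⟨Subtype.val⟩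

theorem memLp (f : FockSpace α p w) : MemLp f (ENNReal.ofReal p) (fockMeasure α p w) :=
  f.2.2

theorem one_le_ofReal [hp : Fact (1 < p)] : 1 ≤ ENNReal.ofReal p := by
  simpa using ENNReal.ofReal_le_ofReal hp.out.le

/-- `‖f‖ = (∫ |f(z)|^p e^{-(pα/2)|z|²} w(z) dA(z))^{1/p}`. For an arbitrary `w` this is only a
seminorm; it is a norm as soon as `w` is positive on a set of positive measure. -/
def fockNorm [Fact (1 < p)] : AddGroupSeminorm (FockSpace α p w) where
  toFun f := (eLpNorm f (ENNReal.ofReal p) (fockMeasure α p w)).toReal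
  map_zero' := by
    change (eLpNorm (0 : ℂ → ℂ) _ _).toReal = 0
    simp
  add_le' f g := by
    rw [← ENNReal.toReal_add f.memLp.eLpNorm_ne_top g.memLp.eLpNorm_ne_top]
    exact ENNReal.toReal_mono
      (ENNReal.add_ne_top.2 ⟨f.memLp.eLpNorm_ne_top, g.memLp.eLpNorm_ne_top⟩)
      (eLpNorm_add_le f.memLp.1 g.memLp.1 one_le_ofReal)
  neg' f := by
    change (eLpNorm (-(f : ℂ → ℂ)) _ _).toReal = _
    rw [eLpNorm_neg]

instance [Fact (1 < p)] : SeminormedAddCommGroup (FockSpace α p w) :=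
  fockNorm.toSeminormedAddCommGroup

instance [Fact (1 < p)] : NormedSpace ℂ (FockSpace α p w) where
  norm_smul_le c f := by
    change (eLpNorm (c • (f : ℂ → ℂ)) _ _).toReal ≤
      ‖c‖ * (eLpNorm (f : ℂ → ℂ) (ENNReal.ofReal p) (fockMeasure α p w)).toReal
    rw [eLpNorm_const_smul, ENNReal.toReal_mul, toReal_enorm]

end FockSpace

/-- The integrand `f(z) \overline{g(z)} e^{-α|z|²}` of the pairing. -/
def pairingIntegrand (α : ℝ) (f g : ℂ → ℂ) (z : ℂ) : ℂ :=
  f z * conj (g z) * (Real.exp (-α * ‖z‖ ^ 2) : ℂ)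

/-- The pairing `⟨f, g⟩_α = ∫ f(z) \overline{g(z)} e^{-α|z|²} dA(z)`. -/
def pairing (α : ℝ) (f g : ℂ → ℂ) : ℂ :=
  ∫ z, pairingIntegrand α f g z

end WeightedFock

end

open MeasureTheory
open scoped ENNReal ComplexConjugate

noncomputable section

namespace WeightedFock

/-! Write q for the conjugate exponent. Give each factor of the pairing one half of the Gaussian,
e^{-α|z|²/2}. Since w^{1/p} w'^{1/q} = 1 almost everywhere, Hölder's inequality yields absolute
convergence and |⟨f,g⟩| ≤ ‖f‖‖g‖. The converse is the real content.

Its analytic core is that the Fock projection Pf(z) = (α/π)⟨f, K_z⟩, with K_z(y) = e^{α y \bar z},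
is bounded on the weighted L^p space (`eLpNorm_proj_le`). After the Gaussian halves are attached,
|K_z(y)| becomes e^{-α|z-y|²/2}, so P is dominated by convolution with a Gaussian on L^p(w dA). The
A_p condition on squares of a single size t lets the mass of a square grow at most exponentially
with its displacement (`doubling_pow`). A Gaussian absorbs this growth, and Hölder plus Tonelli give
the bound (`lintegral_conv_rpow_le`).

The duality then needs no Hahn–Banach extension, because the representing function is explicit: g(z)
= (α/π) \overline{φ(K_z)}. For f of compact support, φ(Pf) = ⟨f,g⟩ (`apply_projElem`), by
approximation with Taylor polynomials. Hence |⟨f,g⟩| ≤ ‖φ‖‖P‖‖f‖, and the converse of Hölder's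
inequality puts g in the dual Fock space with norm at most ‖P‖‖φ‖ (`eLpNorm_repr_le`). Cutting off a
general f and using Pf = f gives ⟨f,g⟩ = φ(f) (`pairing_repr`). Uniqueness is the formula Pg = g for
the other weight (`repr_pairingDual`). -/

/-! ### Squares and Gaussians -/

theorem mem_square_comm {t : ℝ} {u z : ℂ} : u ∈ square t z ↔ z ∈ square t u := by
  simp only [square, Set.mem_ofPred_eq, abs_sub_comm]

theorem isClosed_setOf_mem_square (t : ℝ) : IsClosed {x : ℂ × ℂ | x.2 ∈ square t x.1} := by
  have h1 : Continuous fun x : ℂ × ℂ => |x.2.re - x.1.re| := by fun_prop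
  have h2 : Continuous fun x : ℂ × ℂ => |x.2.im - x.1.im| := by fun_prop
  exact (isClosed_le h1 continuous_const).inter (isClosed_le h2 continuous_const)

theorem measurableSet_square (t : ℝ) (z : ℂ) : MeasurableSet (square t z) :=
  measurable_prodMk_left (isClosed_setOf_mem_square t).measurableSet

theorem volume_square {t : ℝ} (ht : 0 < t) (z : ℂ) :
    volume (square t z) = ENNReal.ofReal (t ^ 2) := by
  have h : square t z = Complex.measurableEquivRealProd ⁻¹'
      (Set.Icc (z.re - t / 2) (z.re + t / 2) ×ˢ Set.Icc (z.im - t / 2) (z.im + t / 2)) := by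
    ext u
    simp only [square, Set.mem_ofPred_eq, Set.mem_preimage, Complex.measurableEquivRealProd_apply,
      Set.mem_prod, Set.mem_Icc, abs_le]
    constructor <;> rintro ⟨⟨_, _⟩, _, _⟩ <;> refine ⟨⟨?_, ?_⟩, ?_, ?_⟩ <;> linarith
  rw [h, Complex.volume_preserving_equiv_real_prod.measure_preimage_equiv, Measure.volume_eq_prod,
    Measure.prod_prod, Real.volume_Icc, Real.volume_Icc, ← ENNReal.ofReal_mul (by linarith)]
  congr 1; ring

theorem norm_sub_le_of_mem_square {t : ℝ} {u z : ℂ} (h : u ∈ square t z) : ‖u - z‖ ≤ t := by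
  have h1 : |(u - z).re| ≤ t / 2 := by simpa using h.1
  have h2 : |(u - z).im| ≤ t / 2 := by simpa using h.2
  linarith [Complex.norm_le_abs_re_add_abs_im (u - z)]

/-- The Gaussian `e^{-c|z|²}` with values in `[0, ∞]`. -/
def gauss (c : ℝ) (z : ℂ) : ℝ≥0∞ := ENNReal.ofReal (Real.exp (-c * ‖z‖ ^ 2))

theorem continuous_gauss (c : ℝ) : Continuous (gauss c) := by
  exact ENNReal.continuous_ofReal.comp (by fun_prop)

@[fun_prop]
theorem measurable_gauss (c : ℝ) : Measurable (gauss c) := (continuous_gauss c).measurable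

theorem gauss_ne_top (c : ℝ) (z : ℂ) : gauss c z ≠ ∞ := ENNReal.ofReal_ne_top

theorem gauss_sub_comm (c : ℝ) (z y : ℂ) : gauss c (z - y) = gauss c (y - z) := by
  simp only [gauss, norm_sub_rev]

theorem gauss_rpow (c : ℝ) (z : ℂ) {r : ℝ} (hr : 0 ≤ r) : gauss c z ^ r = gauss (c * r) z := by
  rw [gauss, gauss, ENNReal.ofReal_rpow_of_nonneg (Real.exp_pos _).le hr, ← Real.exp_mul]
  congr 2; ring

theorem gauss_mul_ofReal_exp (c d K : ℝ) (hK : 0 ≤ K) (z : ℂ) :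
    gauss c z * ENNReal.ofReal (K * Real.exp (d * ‖z‖ ^ 2)) =
      ENNReal.ofReal K * gauss (c - d) z := by
  rw [gauss, gauss, ← ENNReal.ofReal_mul (Real.exp_pos _).le, ← ENNReal.ofReal_mul hK,
    mul_left_comm, ← Real.exp_add]
  congr 3; ring

theorem integrable_exp_neg_mul_norm_sq {c : ℝ} (hc : 0 < c) :
    Integrable fun z : ℂ => Real.exp (-c * ‖z‖ ^ 2) := by
  by_contra h
  have := GaussianFourier.integral_rexp_neg_mul_sq_norm (V := ℂ) hc
  rw [integral_undef h, Complex.finrank_real_complex] at this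
  have h2 : 0 < (Real.pi / c) ^ (((2 : ℕ) : ℝ) / 2) := by positivity
  linarith

theorem lintegral_gauss_lt_top {c : ℝ} (hc : 0 < c) : ∫⁻ z, gauss c z < ∞ := by
  have := (integrable_exp_neg_mul_norm_sq hc).lintegral_lt_top
  simpa [gauss] using this

theorem lintegral_gauss_sub_left (c : ℝ) (z : ℂ) :
    ∫⁻ y, gauss c (z - y) = ∫⁻ y, gauss c y :=
  lintegral_sub_left_eq_self (gauss c) z

/-! ### The A_p condition at one scale and doubling -/

/-- Two measures whose product of averages over squares is bounded, together with the Hölder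
inequality that comes from writing `dA = w^{1/p} w'^{1/q} dA`. -/
structure DualPair (p q t : ℝ) (C : ℝ≥0∞) (μ ν : Measure ℂ) : Prop where
  holderConj : p.HolderConjugate q
  pos : 0 < t
  ne_top : C ≠ ∞
  ap : ∀ z, μ (square t z) ^ (1 / p) * ν (square t z) ^ (1 / q) ≤ C
  holder : ∀ a b : ℂ → ℝ≥0∞, AEMeasurable a → AEMeasurable b →
    ∫⁻ z, a z * b z ≤ (∫⁻ z, a z ^ p ∂μ) ^ (1 / p) * (∫⁻ z, b z ^ q ∂ν) ^ (1 / q)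

namespace DualPair

variable {p q t : ℝ} {C : ℝ≥0∞} {μ ν : Measure ℂ}

theorem symm (h : DualPair p q t C μ ν) : DualPair q p t C ν μ where
  holderConj := h.holderConj.symm
  pos := h.pos
  ne_top := h.ne_top
  ap z := by rw [mul_comm]; exact h.ap z
  holder a b ha hb := by
    rw [mul_comm]
    simpa only [mul_comm] using h.holder b a hb ha

/-- Hölder's inequality for two copies of the indicator of E. It bounds masses from below, where the
A_p condition bounds them from above. -/
theorem volume_le (h : DualPair p q t C μ ν) {E : Set ℂ} (hE : MeasurableSet E) :
    volume E ≤ μ E ^ (1 / p) * ν E ^ (1 / q) := by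
  have h1 : ∀ r : ℝ, 0 < r → ∀ ρ : Measure ℂ,
      ∫⁻ z, (E.indicator (fun _ => (1 : ℝ≥0∞)) z) ^ r ∂ρ = ρ E := by
    intro r hr ρ
    rw [← lintegral_indicator_one hE]
    congr 1 with z
    by_cases hz : z ∈ E <;> simp [hz, hr]
  have h2 := h.holder (E.indicator fun _ => 1) (E.indicator fun _ => 1)
    (aemeasurable_const.indicator hE) (aemeasurable_const.indicator hE)
  rw [h1 p h.holderConj.pos, h1 q h.holderConj.symm.pos] at h2
  refine le_trans (le_of_eq ?_) h2
  rw [← lintegral_indicator_one hE]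
  congr 1 with z
  by_cases hz : z ∈ E <;> simp [hz]

theorem measure_square_ne_zero (h : DualPair p q t C μ ν) (z : ℂ) : μ (square t z) ≠ 0 := by
  intro h0
  have h1 := h.volume_le (measurableSet_square t z)
  rw [h0, volume_square h.pos, ENNReal.zero_rpow_of_pos (by have := h.holderConj.pos; positivity),
    zero_mul, nonpos_iff_eq_zero, ENNReal.ofReal_eq_zero] at h1
  have := h.pos
  have : 0 < t ^ 2 := by positivity
  linarith

theorem measure_square_ne_top (h : DualPair p q t C μ ν) (z : ℂ) : μ (square t z) ≠ ∞ := by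
  intro h0
  have h1 := h.ap z
  have hp := h.holderConj.pos
  have hq := h.holderConj.symm.pos
  rw [h0, ENNReal.top_rpow_of_pos (by positivity), ENNReal.top_mul] at h1
  · exact h.ne_top (top_le_iff.1 h1)
  -- The ν-mass is positive by symmetry, so an infinite μ-mass would make the A_p product infinite.
  · simp [hq.le, h.symm.measure_square_ne_zero z]

/-- Two squares of side t with centers at distance at most t/2 share the square of side t/2 around
the midpoint. There `volume_le` bounds μ(Q(z')) from below in terms of ν(Q(z)), and the A_p
condition at z trades ν(Q(z)) for μ(Q(z)). -/
theorem doubling_near (h : DualPair p q t C μ ν) :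
    ∃ D : ℝ≥0∞, D ≠ ∞ ∧ ∀ z z' : ℂ, ‖z - z'‖ ≤ t / 2 →
      μ (square t z) ≤ D * μ (square t z') := by
  have hp := h.holderConj.pos
  have hq := h.holderConj.symm.pos
  have ht := h.pos
  set δ : ℝ≥0∞ := ENNReal.ofReal ((t / 2) ^ 2)
  have hδ0 : δ ≠ 0 := by
    have : 0 < (t / 2) ^ 2 := by positivity
    exact (ENNReal.ofReal_pos.2 this).ne'
  have hδt : δ ≠ ∞ := ENNReal.ofReal_ne_top
  refine ⟨(C / δ) ^ p, ENNReal.rpow_ne_top_of_nonneg hp.le (ENNReal.div_ne_top h.ne_top hδ0), ?_⟩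
  intro z z' hzz
  set X := ν (square t z) ^ (1 / q)
  have hX0 : X ≠ 0 := by
    simp [X, hq.le, h.symm.measure_square_ne_zero z]
  have hXt : X ≠ ∞ :=
    ENNReal.rpow_ne_top_of_nonneg (by positivity) (h.symm.measure_square_ne_top z)
  set m : ℂ := (z + z') / 2
  have hre : |z.re - z'.re| ≤ t / 2 := by
    simpa using (Complex.abs_re_le_norm (z - z')).trans hzz
  have him : |z.im - z'.im| ≤ t / 2 := by
    simpa using (Complex.abs_im_le_norm (z - z')).trans hzz
  have hmre : m.re = (z.re + z'.re) / 2 := by simp [m]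
  have hmim : m.im = (z.im + z'.im) / 2 := by simp [m]
  have hs : square (t / 2) m ⊆ square t z ∧ square (t / 2) m ⊆ square t z' := by
    constructor <;> rintro u ⟨h1, h2⟩ <;> rw [hmre] at h1 <;> rw [hmim] at h2 <;>
      rw [abs_le] at h1 h2 hre him <;> constructor <;> rw [abs_le] <;> constructor <;> linarith
  have h1 : δ ≤ μ (square t z') ^ (1 / p) * X := by
    calc δ = volume (square (t / 2) m) := (volume_square (by positivity) m).symm
      _ ≤ _ := h.volume_le (measurableSet_square _ _)
      _ ≤ _ := by
        gcongr
        · exact hs.2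
        · exact ENNReal.rpow_le_rpow (measure_mono hs.1) (by positivity)
  have h2 : μ (square t z) ^ (1 / p) ≤ C / X := by
    rw [ENNReal.le_div_iff_mul_le (Or.inl hX0) (Or.inl hXt)]
    exact h.ap z
  have h3 : δ / X ≤ μ (square t z') ^ (1 / p) :=
    ENNReal.div_le_of_le_mul h1
  have h4 : μ (square t z) ^ (1 / p) ≤ C / δ * μ (square t z') ^ (1 / p) := by
    calc _ ≤ C / X := h2
      _ = C / δ * (δ / X) := by
        rw [div_eq_mul_inv, div_eq_mul_inv, div_eq_mul_inv, mul_assoc, ← mul_assoc δ⁻¹,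
          ENNReal.inv_mul_cancel hδ0 hδt, one_mul]
      _ ≤ _ := by gcongr
  have h5 := ENNReal.rpow_le_rpow h4 hp.le
  rwa [ENNReal.mul_rpow_of_nonneg _ _ hp.le, ← ENNReal.rpow_mul, ← ENNReal.rpow_mul,
    one_div_mul_cancel hp.ne', ENNReal.rpow_one, ENNReal.rpow_one] at h5

/-- A chain of n steps of length at most t/2 along the segment costs one doubling constant per step.
The constant is enlarged to be at least 1 so that its logarithm is nonnegative. -/
theorem doubling_pow (h : DualPair p q t C μ ν) :
    ∃ D : ℝ, 1 ≤ D ∧ ∀ (n : ℕ) (z z' : ℂ), ‖z - z'‖ ≤ n * (t / 2) →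
      μ (square t z) ≤ ENNReal.ofReal (D ^ n) * μ (square t z') := by
  obtain ⟨D, hD, hd⟩ := h.doubling_near
  refine ⟨max D.toReal 1, le_max_right _ _, fun n => ?_⟩
  induction n with
  | zero =>
    intro z z' hz
    have : z = z' := by simpa [sub_eq_zero] using hz
    simp [this]
  | succ n ih =>
    intro z z' hz
    push_cast at hz
    have hn : (0 : ℝ) < n + 1 := by positivity
    -- This point of the segment is one step from z and n steps from z'.
    set y : ℂ := z' + ((n / (n + 1) : ℝ) : ℂ) * (z - z')
    have h1 : ‖y - z'‖ ≤ n * (t / 2) := by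
      simp only [y, add_sub_cancel_left, norm_mul, Complex.norm_real, Real.norm_eq_abs]
      rw [abs_of_nonneg (by positivity)]
      calc (n / (n + 1) : ℝ) * ‖z - z'‖ ≤ (n / (n + 1) : ℝ) * ((n + 1) * (t / 2)) := by gcongr
        _ = n * (t / 2) := by field_simp
    have h2 : ‖z - y‖ ≤ t / 2 := by
      have : z - y = ((1 / (n + 1) : ℝ) : ℂ) * (z - z') := by
        have : ((n : ℂ) + 1) ≠ 0 := by exact_mod_cast hn.ne'
        simp only [y]; push_cast; field_simp; ring
      rw [this, norm_mul, Complex.norm_real, Real.norm_eq_abs, abs_of_nonneg (by positivity)]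
      calc (1 / (n + 1) : ℝ) * ‖z - z'‖ ≤ (1 / (n + 1) : ℝ) * ((n + 1) * (t / 2)) := by gcongr
        _ = t / 2 := by field_simp
    calc μ (square t z) ≤ D * μ (square t y) := hd z y h2
      _ ≤ ENNReal.ofReal (max D.toReal 1) *
          (ENNReal.ofReal (max D.toReal 1 ^ n) * μ (square t z')) := by
        gcongr
        · rw [← ENNReal.ofReal_toReal hD]
          exact ENNReal.ofReal_le_ofReal (by simp)
        · exact ih y z' h1
      _ = _ := by
        rw [← mul_assoc, ← ENNReal.ofReal_mul (by positivity), pow_succ']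

/-- An exponential in the distance is smaller than any Gaussian e^{cx²} up to a constant, so the
loss can later be absorbed by part of a decaying Gaussian. -/
theorem doubling_gauss (h : DualPair p q t C μ ν) {c : ℝ} (hc : 0 < c) :
    ∃ K : ℝ, 0 < K ∧ ∀ z z' : ℂ,
      μ (square t z) ≤ ENNReal.ofReal (K * Real.exp (c * ‖z - z'‖ ^ 2)) * μ (square t z') := by
  obtain ⟨D, hD, hd⟩ := h.doubling_pow
  have ht := h.pos
  set L := Real.log D
  have hL : 0 ≤ L := Real.log_nonneg hD
  -- With L = log D and at most 2x/t + 1 steps, the exponent is at most (2L/t)x + L. Completing the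
  -- square bounds the linear term by (2L/t)²/(4c) + cx²; the extra L pays for rounding up.
  refine ⟨Real.exp (L + (2 * L / t) ^ 2 / (4 * c)), Real.exp_pos _, fun z z' => ?_⟩
  set x := ‖z - z'‖
  have hx : 0 ≤ x := norm_nonneg _
  have h1 : x ≤ ⌈2 * x / t⌉₊ * (t / 2) := by
    have := Nat.le_ceil (2 * x / t)
    calc x = 2 * x / t * (t / 2) := by field_simp
      _ ≤ _ := by gcongr
  refine (hd _ z z' h1).trans ?_
  gcongr
  rw [← Real.exp_add, ← Real.exp_log (by positivity : 0 < D), ← Real.exp_nat_mul,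
    Real.exp_le_exp]
  have h2 : (⌈2 * x / t⌉₊ : ℝ) ≤ 2 * x / t + 1 := (Nat.ceil_lt_add_one (by positivity)).le
  have h3 : 2 * L / t * x ≤ (2 * L / t) ^ 2 / (4 * c) + c * x ^ 2 := by
    have : 0 ≤ (2 * L / t - 2 * c * x) ^ 2 / (4 * c) := by positivity
    have e : (2 * L / t - 2 * c * x) ^ 2 / (4 * c) =
        (2 * L / t) ^ 2 / (4 * c) - 2 * L / t * x + c * x ^ 2 := by field_simp; ring
    linarith
  calc (⌈2 * x / t⌉₊ : ℝ) * L ≤ (2 * x / t + 1) * L := by gcongr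
    _ = 2 * L / t * x + L := by ring
    _ ≤ _ := by linarith

/-! ### Gaussian means and Gaussian convolution -/

theorem measurable_measure_square (t : ℝ) (μ : Measure ℂ) [SFinite μ] :
    Measurable fun z => μ (square t z) :=
  measurable_measure_prodMk_left (isClosed_setOf_mem_square t).measurableSet

/-- The Gaussian mean of the measure is controlled by the measure of the square. -/
theorem lintegral_gauss_le (h : DualPair p q t C μ ν) [SFinite μ] {c : ℝ} (hc : 0 < c) :
    ∃ K : ℝ≥0∞, K ≠ ∞ ∧ ∀ z, ∫⁻ y, gauss c (z - y) ∂μ ≤ K * μ (square t z) := by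
  have ht := h.pos
  obtain ⟨K, hK, hd⟩ := h.doubling_gauss (c := c / 4) (by positivity)
  set A : ℝ≥0∞ := ENNReal.ofReal (Real.exp (c * t ^ 2)) / ENNReal.ofReal (t ^ 2)
  have hV : ENNReal.ofReal (t ^ 2) ≠ 0 := by
    have : 0 < t ^ 2 := by positivity
    exact (ENNReal.ofReal_pos.2 this).ne'
  have hA : A ≠ ∞ := ENNReal.div_ne_top ENNReal.ofReal_ne_top hV
  refine ⟨A * (ENNReal.ofReal K * ∫⁻ y, gauss (c / 4) y), ENNReal.mul_ne_top hA
    (ENNReal.mul_ne_top ENNReal.ofReal_ne_top (lintegral_gauss_lt_top (by positivity)).ne), ?_⟩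
  intro z
  -- The value at y is dominated by an average over the square around y of the wider Gaussian,
  -- because |z-u|² ≤ 2|z-y|² + 2t². After Tonelli and the symmetry of u ∈ Q(y), the inner integral
  -- becomes μ(Q(u)), which doubling compares with μ(Q(z)).
  have h1 : ∀ y, gauss c (z - y) ≤
      A * ∫⁻ u, (square t y).indicator (fun u => gauss (c / 2) (z - u)) u := by
    intro y
    rw [lintegral_indicator (measurableSet_square t y)]
    have h2 : ∀ u ∈ square t y, gauss c (z - y) * ENNReal.ofReal (Real.exp (-(c * t ^ 2))) ≤
        gauss (c / 2) (z - u) := by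
      intro u hu
      have h3 := norm_sub_le_of_mem_square hu
      have h4 : ‖z - u‖ ≤ ‖z - y‖ + t := by
        calc ‖z - u‖ = ‖(z - y) - (u - y)‖ := by congr 1; ring
          _ ≤ ‖z - y‖ + ‖u - y‖ := norm_sub_le _ _
          _ ≤ _ := by gcongr
      rw [gauss, gauss, ← ENNReal.ofReal_mul (Real.exp_pos _).le, ← Real.exp_add]
      apply ENNReal.ofReal_le_ofReal
      rw [Real.exp_le_exp]
      have h5 : ‖z - u‖ ^ 2 ≤ 2 * ‖z - y‖ ^ 2 + 2 * t ^ 2 := by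
        have := pow_le_pow_left₀ (norm_nonneg _) h4 2
        nlinarith [sq_nonneg (‖z - y‖ - t)]
      nlinarith
    have h6 := setLIntegral_mono (μ := volume) (by fun_prop) h2
    rw [setLIntegral_const, volume_square ht] at h6
    refine le_trans (le_of_eq ?_) (mul_le_mul_right h6 A)
    rw [mul_comm (gauss c (z - y)), Real.exp_neg, ENNReal.ofReal_inv_of_pos (Real.exp_pos _)]
    simp only [A, div_eq_mul_inv]
    set a := ENNReal.ofReal (Real.exp (c * t ^ 2))
    have ha0 : a ≠ 0 := by simpa [a] using Real.exp_pos _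
    have hat : a ≠ ∞ := ENNReal.ofReal_ne_top
    calc gauss c (z - y) = (a * a⁻¹) * ((ENNReal.ofReal (t ^ 2))⁻¹ * ENNReal.ofReal (t ^ 2))
          * gauss c (z - y) := by
          rw [ENNReal.mul_inv_cancel ha0 hat, ENNReal.inv_mul_cancel hV ENNReal.ofReal_ne_top,
            one_mul, one_mul]
      _ = _ := by ring
  have hm : Measurable (Function.uncurry fun y u : ℂ =>
      (square t y).indicator (fun u => gauss (c / 2) (z - u)) u) := by
    have : (Function.uncurry fun y u : ℂ =>
      (square t y).indicator (fun u => gauss (c / 2) (z - u)) u) =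
        {x : ℂ × ℂ | x.2 ∈ square t x.1}.indicator fun x => gauss (c / 2) (z - x.2) := by
      ext ⟨y, u⟩
      simp only [Function.uncurry, Set.indicator, Set.mem_ofPred_eq]
    rw [this]
    exact Measurable.indicator (by fun_prop) (isClosed_setOf_mem_square t).measurableSet
  calc ∫⁻ y, gauss c (z - y) ∂μ
      ≤ ∫⁻ y, A * ∫⁻ u, (square t y).indicator (fun u => gauss (c / 2) (z - u)) u ∂volume ∂μ :=
        lintegral_mono h1
    _ = A * ∫⁻ y, ∫⁻ u, (square t y).indicator (fun u => gauss (c / 2) (z - u)) u ∂volume ∂μ :=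
        lintegral_const_mul' _ _ hA
    _ = A * ∫⁻ u, ∫⁻ y, (square t y).indicator (fun u => gauss (c / 2) (z - u)) u ∂μ := by
        rw [lintegral_lintegral_swap hm.aemeasurable]
    _ = A * ∫⁻ u, gauss (c / 2) (z - u) * μ (square t u) := by
        congr 2 with u
        have : (fun y => (square t y).indicator (fun u => gauss (c / 2) (z - u)) u) =
            (square t u).indicator fun _ => gauss (c / 2) (z - u) := by
          ext y
          by_cases hy : u ∈ square t y
          · rw [Set.indicator_of_mem hy, Set.indicator_of_mem (mem_square_comm.1 hy)]
          · rw [Set.indicator_of_notMem hy,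
              Set.indicator_of_notMem fun h' => hy (mem_square_comm.1 h')]
        rw [this, lintegral_indicator_const (measurableSet_square t u)]
    _ ≤ A * ∫⁻ u, (ENNReal.ofReal K * gauss (c / 4) (z - u)) * μ (square t z) := by
        refine mul_le_mul_right (lintegral_mono fun u => ?_) A
        have := hd u z
        rw [norm_sub_rev] at this
        refine (mul_le_mul_right this (gauss (c / 2) (z - u))).trans (le_of_eq ?_)
        rw [← mul_assoc, gauss_mul_ofReal_exp _ _ _ hK.le]
        congr 3; ring
    _ = _ := by
        rw [lintegral_mul_const _ (by fun_prop), lintegral_const_mul _ (by fun_prop),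
          lintegral_gauss_sub_left, mul_assoc, mul_assoc, mul_assoc]

theorem lintegral_gauss_lt_top (h : DualPair p q t C μ ν) [SFinite μ] {c : ℝ} (hc : 0 < c) :
    ∫⁻ y, gauss c y ∂μ < ∞ := by
  obtain ⟨K, hK, hk⟩ := h.lintegral_gauss_le hc
  refine lt_of_le_of_lt ?_ (ENNReal.mul_lt_top hK.lt_top (h.measure_square_ne_top 0).lt_top)
  simpa [gauss] using hk 0

/-- Convolution with a Gaussian is bounded on `L^p(μ)`. -/
theorem lintegral_conv_rpow_le (h : DualPair p q t C μ ν) [SFinite μ] [SFinite ν] {c : ℝ}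
    (hc : 0 < c) (hμ : μ ≪ volume) :
    ∃ K : ℝ≥0∞, K ≠ ∞ ∧ ∀ F : ℂ → ℝ≥0∞, AEMeasurable F →
      ∫⁻ z, (∫⁻ y, gauss c (z - y) * F y) ^ p ∂μ ≤ K * ∫⁻ y, F y ^ p ∂μ := by
  have hp := h.holderConj.pos
  have hq := h.holderConj.symm.pos
  obtain ⟨K₁, hK₁, hk₁⟩ := h.symm.lintegral_gauss_le hc
  obtain ⟨K₂, hK₂, hk₂⟩ := h.doubling_gauss (c := c / 2) (by positivity)
  obtain ⟨K₃, hK₃, hk₃⟩ := h.lintegral_gauss_le (c := c / 2) (by positivity)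
  set K₄ : ℝ≥0∞ := K₁ ^ (p / q) * C ^ p
  have hpq : 0 ≤ p / q := by positivity
  have hK₄ : K₄ ≠ ∞ := ENNReal.mul_ne_top (ENNReal.rpow_ne_top_of_nonneg hpq hK₁)
    (ENNReal.rpow_ne_top_of_nonneg hp.le h.ne_top)
  refine ⟨K₄ * (ENNReal.ofReal K₂ * K₃), ENNReal.mul_ne_top hK₄
    (ENNReal.mul_ne_top ENNReal.ofReal_ne_top hK₃), ?_⟩
  have key : ∀ F : ℂ → ℝ≥0∞, Measurable F →
      ∫⁻ z, (∫⁻ y, gauss c (z - y) * F y) ^ p ∂μ ≤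
        K₄ * (ENNReal.ofReal K₂ * K₃) * ∫⁻ y, F y ^ p ∂μ := by
    intro F hF
    have h1 : ∀ z, (∫⁻ y, gauss c (z - y) * F y) ^ p ≤
        K₄ * ∫⁻ y, (μ (square t z))⁻¹ * (gauss c (z - y) * F y ^ p) ∂μ := by
      intro z
      -- The Gaussian is split with exponents 1/p and 1/q, so that Hölder leaves a full Gaussian in
      -- both the μ-integral and the ν-integral.
      have e1 : ∀ y, gauss c (z - y) * F y =
          (gauss (c * (1 / p)) (z - y) * F y) * gauss (c * (1 / q)) (z - y) := by
        intro y
        have : gauss c (z - y) = gauss (c * (1 / p)) (z - y) * gauss (c * (1 / q)) (z - y) := by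
          rw [← gauss_rpow _ _ (by positivity), ← gauss_rpow _ _ (by positivity),
            ← ENNReal.rpow_add _ _ (by simpa [gauss] using Real.exp_pos _) (gauss_ne_top _ _)]
          have := h.holderConj.inv_add_inv_eq_one
          simp only [one_div]
          rw [this, ENNReal.rpow_one]
        rw [this]; ring
      have h2 := h.holder (fun y => gauss (c * (1 / p)) (z - y) * F y)
        (fun y => gauss (c * (1 / q)) (z - y)) (by fun_prop) (by fun_prop)
      have e2 : ∀ y, (gauss (c * (1 / p)) (z - y) * F y) ^ p = gauss c (z - y) * F y ^ p := by
        intro y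
        rw [ENNReal.mul_rpow_of_nonneg _ _ hp.le, gauss_rpow _ _ hp.le]
        congr 2; field_simp
      have e3 : ∀ y, gauss (c * (1 / q)) (z - y) ^ q = gauss c (z - y) := by
        intro y
        rw [gauss_rpow _ _ hq.le]
        congr 1; field_simp
      simp only [← e1, e2, e3] at h2
      have h3 := ENNReal.rpow_le_rpow h2 hp.le
      rw [ENNReal.mul_rpow_of_nonneg _ _ hp.le, ← ENNReal.rpow_mul, ← ENNReal.rpow_mul,
        one_div_mul_cancel hp.ne', ENNReal.rpow_one, one_div_mul_eq_div] at h3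
      refine h3.trans ?_
      -- The p-th power of the A_p condition turns the Gaussian ν-mean into the weight 1/μ(Q(z)).
      have h4 : ν (square t z) ^ (p / q) ≤ C ^ p * (μ (square t z))⁻¹ := by
        have := ENNReal.rpow_le_rpow (h.ap z) hp.le
        rw [ENNReal.mul_rpow_of_nonneg _ _ hp.le, ← ENNReal.rpow_mul, ← ENNReal.rpow_mul,
          one_div_mul_cancel hp.ne', ENNReal.rpow_one, one_div_mul_eq_div] at this
        rw [← div_eq_mul_inv, ENNReal.le_div_iff_mul_le (Or.inl (h.measure_square_ne_zero z))
          (Or.inl (h.measure_square_ne_top z)), mul_comm]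
        exact this
      have h5 : (∫⁻ y, gauss c (z - y) ∂ν) ^ (p / q) ≤ K₄ * (μ (square t z))⁻¹ := by
        refine (ENNReal.rpow_le_rpow (hk₁ z) hpq).trans ?_
        rw [ENNReal.mul_rpow_of_nonneg _ _ hpq, mul_assoc]
        gcongr
      rw [lintegral_const_mul _ (by fun_prop), ← mul_assoc, mul_comm]
      gcongr
    have hm := measurable_measure_square t μ
    calc ∫⁻ z, (∫⁻ y, gauss c (z - y) * F y) ^ p ∂μ
        ≤ ∫⁻ z, K₄ * ∫⁻ y, (μ (square t z))⁻¹ * (gauss c (z - y) * F y ^ p) ∂μ ∂μ :=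
          lintegral_mono h1
      _ = K₄ * ∫⁻ z, ∫⁻ y, (μ (square t z))⁻¹ * (gauss c (z - y) * F y ^ p) ∂μ ∂μ :=
          lintegral_const_mul' _ _ hK₄
      _ = K₄ * ∫⁻ y, ∫⁻ z, (μ (square t z))⁻¹ * (gauss c (z - y) * F y ^ p) ∂μ ∂μ := by
          rw [lintegral_lintegral_swap]
          have hm' : Measurable fun x : ℂ × ℂ => (μ (square t x.1))⁻¹ :=
            (hm.comp measurable_fst).inv
          exact (hm'.mul (by fun_prop :
            Measurable fun x : ℂ × ℂ => gauss c (x.1 - x.2) * F x.2 ^ p)).aemeasurable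
      _ ≤ K₄ * ∫⁻ y, ENNReal.ofReal K₂ * K₃ * F y ^ p ∂μ := by
          gcongr with y
          have h6 : ∀ z, (μ (square t z))⁻¹ * (gauss c (z - y) * F y ^ p) ≤
              ENNReal.ofReal K₂ * ((μ (square t y))⁻¹ * F y ^ p) * gauss (c / 2) (y - z) := by
            intro z
            -- Doubling recenters the weight from z to y at the cost of half the Gaussian. The other
            -- half integrates to a multiple of μ(Q(y)), which cancels it.
            have h7 : (μ (square t z))⁻¹ ≤
                ENNReal.ofReal (K₂ * Real.exp (c / 2 * ‖z - y‖ ^ 2)) * (μ (square t y))⁻¹ := by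
              have := hk₂ y z
              rw [norm_sub_rev] at this
              rw [← div_eq_mul_inv, ENNReal.le_div_iff_mul_le
                (Or.inl (h.measure_square_ne_zero y)) (Or.inl (h.measure_square_ne_top y)),
                mul_comm, ← div_eq_mul_inv]
              exact ENNReal.div_le_of_le_mul this
            calc _ ≤ (ENNReal.ofReal (K₂ * Real.exp (c / 2 * ‖z - y‖ ^ 2)) * (μ (square t y))⁻¹)
                  * (gauss c (z - y) * F y ^ p) := by gcongr
              _ = (gauss c (z - y) * ENNReal.ofReal (K₂ * Real.exp (c / 2 * ‖z - y‖ ^ 2))) *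
                  ((μ (square t y))⁻¹ * F y ^ p) := by ring
              _ = _ := by
                rw [gauss_mul_ofReal_exp _ _ _ hK₂.le, sub_half, gauss_sub_comm]; ring
          refine (lintegral_mono h6).trans ?_
          rw [lintegral_const_mul _ (by fun_prop)]
          refine (mul_le_mul_right (hk₃ y) _).trans (le_of_eq ?_)
          calc _ = ENNReal.ofReal K₂ * K₃ * F y ^ p *
                ((μ (square t y))⁻¹ * μ (square t y)) := by ring
            _ = _ := by
              rw [ENNReal.inv_mul_cancel (h.measure_square_ne_zero y)
                (h.measure_square_ne_top y), mul_one]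
      _ = _ := by rw [lintegral_const_mul _ (by fun_prop), mul_assoc K₄]
  intro F hF
  -- Only Lebesgue-null sets are ignored in passing to a measurable representative; μ ≪ dA makes
  -- this harmless on the right-hand side too.
  have h1 : ∀ z, ∫⁻ y, gauss c (z - y) * F y = ∫⁻ y, gauss c (z - y) * hF.mk F y := fun z =>
    lintegral_congr_ae (hF.ae_eq_mk.mono fun y hy => by simp only [hy])
  have h2 : ∫⁻ y, F y ^ p ∂μ = ∫⁻ y, hF.mk F y ^ p ∂μ :=
    lintegral_congr_ae ((hμ.ae_eq hF.ae_eq_mk).mono fun y hy => by simp only [hy])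
  simp only [h1, h2]
  exact key _ hF.measurable_mk

end DualPair

/-! ### Weighted measures and the duality hypotheses -/

/-- The measure `w dA`. -/
def weightMeasure (w : ℂ → ℝ) : Measure ℂ :=
  volume.withDensity fun z => ENNReal.ofReal (w z)

instance (w : ℂ → ℝ) : SFinite (weightMeasure w) := by
  unfold weightMeasure; infer_instance

theorem weightMeasure_absolutelyContinuous (w : ℂ → ℝ) : weightMeasure w ≪ volume :=
  withDensity_absolutelyContinuous _ _

theorem fockMeasure_eq {w : ℂ → ℝ} (hw : AEMeasurable w) (α p : ℝ) :
    fockMeasure α p w = (weightMeasure w).withDensity (gauss (p * α / 2)) := by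
  rw [weightMeasure, ← withDensity_mul₀ hw.ennreal_ofReal (measurable_gauss _).aemeasurable,
    fockMeasure]
  congr 1 with z
  rw [ENNReal.ofReal_mul (Real.exp_pos _).le, Pi.mul_apply, mul_comm, gauss]

theorem fockMeasure_absolutelyContinuous (α p : ℝ) (w : ℂ → ℝ) :
    fockMeasure α p w ≪ volume :=
  withDensity_absolutelyContinuous _ _

theorem absolutelyContinuous_fockMeasure {w : ℂ → ℝ} (hw : AEMeasurable w)
    (hpos : ∀ᵐ z, 0 < w z) (α p : ℝ) : volume ≪ fockMeasure α p w := by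
  refine withDensity_absolutelyContinuous' ?_ ?_
  · exact ((by fun_prop : Measurable fun z : ℂ =>
      Real.exp (-(p * α / 2) * ‖z‖ ^ 2)).aemeasurable.mul hw).ennreal_ofReal
  · filter_upwards [hpos] with z hz
    exact (ENNReal.ofReal_pos.2 (by positivity)).ne'

/-- The factor e^{-pα|z|²/2} is the p-th power of e^{-α|z|²/2}. Moving it into the function leaves a
Gaussian that does not depend on p, which makes the two exponents symmetric. -/
theorem lintegral_fockMeasure {w : ℂ → ℝ} (hw : AEMeasurable w) {p : ℝ} (hp : 0 < p) (α : ℝ)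
    (f : ℂ → ℝ≥0∞) :
    ∫⁻ z, f z ^ p ∂(fockMeasure α p w) =
      ∫⁻ z, (f z * gauss (α / 2) z) ^ p ∂(weightMeasure w) := by
  rw [fockMeasure_eq hw, lintegral_withDensity_eq_lintegral_mul_non_measurable _
    (measurable_gauss _) (Filter.Eventually.of_forall fun z => (gauss_ne_top _ z).lt_top)]
  congr 1 with z
  rw [Pi.mul_apply, ENNReal.mul_rpow_of_nonneg _ _ hp.le, gauss_rpow _ _ hp.le, mul_comm]
  congr 2; ring

theorem eLpNorm_fockMeasure {w : ℂ → ℝ} (hw : AEMeasurable w) {p : ℝ} (hp : 0 < p) (α : ℝ)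
    (f : ℂ → ℂ) :
    eLpNorm f (ENNReal.ofReal p) (fockMeasure α p w) =
      (∫⁻ z, (‖f z‖ₑ * gauss (α / 2) z) ^ p ∂(weightMeasure w)) ^ (1 / p) := by
  rw [eLpNorm_eq_lintegral_rpow_enorm_toReal (by simpa using hp) ENNReal.ofReal_ne_top,
    ENNReal.toReal_ofReal hp.le, lintegral_fockMeasure hw hp]

/-- The hypotheses under which the duality is proved. They are symmetric in `(p, w)` and
`(q, w')`. -/
structure DualWeights (α p q t : ℝ) (C : ℝ≥0∞) (w w' : ℂ → ℝ) : Prop where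
  alpha_pos : 0 < α
  pair : DualPair p q t C (weightMeasure w) (weightMeasure w')
  aemeasurable : AEMeasurable w
  aemeasurable' : AEMeasurable w'
  ae_pos : ∀ᵐ z, 0 < w z
  ae_eq : ∀ᵐ z, w' z = w z ^ (-(q / p))

theorem ofReal_rpow_mul_ofReal_rpow {p q x : ℝ} (hpq : p.HolderConjugate q) (hx : 0 < x) :
    ENNReal.ofReal x ^ (1 / p) * ENNReal.ofReal (x ^ (-(q / p))) ^ (1 / q) = 1 := by
  have hp := hpq.pos
  have hq := hpq.symm.pos
  rw [ENNReal.ofReal_rpow_of_pos hx, ENNReal.ofReal_rpow_of_pos (by positivity),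
    ← ENNReal.ofReal_mul (by positivity), ← Real.rpow_mul hx.le, ← Real.rpow_add hx]
  have : 1 / p + -(q / p) * (1 / q) = 0 := by field_simp; ring
  rw [this, Real.rpow_zero, ENNReal.ofReal_one]

theorem lintegral_weightMeasure {w : ℂ → ℝ} (hw : AEMeasurable w) {p : ℝ} (hp : 0 < p)
    (a : ℂ → ℝ≥0∞) :
    ∫⁻ z, a z ^ p ∂(weightMeasure w) =
      ∫⁻ z, (ENNReal.ofReal (w z) ^ (1 / p) * a z) ^ p := by
  rw [weightMeasure, lintegral_withDensity_eq_lintegral_mul_non_measurable₀ _ hw.ennreal_ofReal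
    (Filter.Eventually.of_forall fun z => ENNReal.ofReal_lt_top)]
  congr 1 with z
  rw [Pi.mul_apply, ENNReal.mul_rpow_of_nonneg _ _ hp.le, ← ENNReal.rpow_mul,
    one_div_mul_cancel hp.ne', ENNReal.rpow_one]

theorem dualWeights_of_memApRestricted {α p p' : ℝ} (hα : 0 < α) (hpp' : p.HolderConjugate p')
    {w w' : ℂ → ℝ} (hw : MemApRestricted p w) (hw' : ∀ z, w' z = w z ^ (-(p' / p))) :
    ∃ t C, DualWeights α p p' t C w w' := by
  have hp := hpp'.pos
  have hq := hpp'.symm.pos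
  obtain ⟨t, ht, hap⟩ := hw.exists_const_lt_top
  have hm : AEMeasurable w := hw.isWeight.locallyIntegrable.aestronglyMeasurable.aemeasurable
  have hm' : AEMeasurable w' := by
    have : w' = fun z => w z ^ (-(p' / p)) := funext hw'
    rw [this]; exact hm.pow_const _
  set V : ℝ≥0∞ := ENNReal.ofReal (t ^ 2)
  have hV0 : V ≠ 0 := (ENNReal.ofReal_pos.2 (by positivity)).ne'
  have hVt : V ≠ ∞ := ENNReal.ofReal_ne_top
  -- The p-th root of the A_p product carries the exponents 1/p and 1/q. Undoing the averages
  -- contributes V^{1/p} V^{1/q} = V, the area of the square.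
  refine ⟨t, apConst p t w ^ (1 / p) * V, hα, ⟨hpp', ht, ?_, ?_, ?_⟩, hm, hm', hw.ae_pos,
    Filter.Eventually.of_forall hw'⟩
  · exact ENNReal.mul_ne_top (ENNReal.rpow_ne_top_of_nonneg (by positivity) hap.ne) hVt
  · intro z
    have h1 : (⨍⁻ u in square t z, ENNReal.ofReal (w u) ∂volume) *
        (⨍⁻ u in square t z, ENNReal.ofReal (w u ^ (-(p.conjExponent / p))) ∂volume) ^
          (p / p.conjExponent) ≤ apConst p t w :=
      le_iSup (fun z : ℂ => (⨍⁻ u in square t z, ENNReal.ofReal (w u) ∂volume) *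
        (⨍⁻ u in square t z, ENNReal.ofReal (w u ^ (-(p.conjExponent / p))) ∂volume) ^
          (p / p.conjExponent)) z
    rw [← hpp'.conjExponent_eq] at hw'
    rw [← hpp'.conjExponent_eq]
    rw [← hpp'.conjExponent_eq] at hq hpp'
    set q := p.conjExponent
    simp only [← hw', setLAverage_eq, volume_square ht] at h1
    rw [← withDensity_apply _ (measurableSet_square t z),
      ← withDensity_apply _ (measurableSet_square t z)] at h1
    change weightMeasure w (square t z) / V * (weightMeasure w' (square t z) / V) ^ (p / q) ≤
      apConst p t w at h1
    have h2 := ENNReal.rpow_le_rpow h1 (by positivity : 0 ≤ 1 / p)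
    rw [ENNReal.mul_rpow_of_nonneg _ _ (by positivity), ← ENNReal.rpow_mul,
      show p / q * (1 / p) = 1 / q by field_simp, ENNReal.div_rpow_of_nonneg _ _ (by positivity),
      ENNReal.div_rpow_of_nonneg _ _ (by positivity)] at h2
    have h3 : V ^ (1 / p) * V ^ (1 / q) = V := by
      rw [← ENNReal.rpow_add _ _ hV0 hVt]
      have := hpp'.inv_add_inv_eq_one
      rw [one_div, one_div, this, ENNReal.rpow_one]
    have hVr : ∀ r : ℝ, (V ^ r)⁻¹ * V ^ r = 1 := fun r =>
      ENNReal.inv_mul_cancel (ENNReal.rpow_pos (pos_iff_ne_zero.2 hV0) hVt).ne'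
        (ENNReal.rpow_ne_top_of_ne_zero hV0 hVt)
    calc weightMeasure w (square t z) ^ (1 / p) * weightMeasure w' (square t z) ^ (1 / q)
        = weightMeasure w (square t z) ^ (1 / p) * ((V ^ (1 / p))⁻¹ * V ^ (1 / p)) *
          (weightMeasure w' (square t z) ^ (1 / q) * ((V ^ (1 / q))⁻¹ * V ^ (1 / q))) := by
          rw [hVr, hVr, mul_one, mul_one]
      _ = (weightMeasure w (square t z) ^ (1 / p) / V ^ (1 / p) *
          (weightMeasure w' (square t z) ^ (1 / q) / V ^ (1 / q))) *
          (V ^ (1 / p) * V ^ (1 / q)) := by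
          simp only [div_eq_mul_inv]; ring
      _ ≤ _ := by
          rw [h3]; gcongr
  · intro a b ha hb
    rw [lintegral_weightMeasure hm hp, lintegral_weightMeasure hm' hq]
    refine le_trans (le_of_eq ?_) (ENNReal.lintegral_mul_le_Lp_mul_Lq volume hpp'
      ((hm.ennreal_ofReal.pow_const _).mul ha) ((hm'.ennreal_ofReal.pow_const _).mul hb))
    refine lintegral_congr_ae ?_
    filter_upwards [hw.ae_pos] with z hz
    have h1 := ofReal_rpow_mul_ofReal_rpow hpp' hz
    rw [← hw'] at h1
    simp only [Pi.mul_apply]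
    calc a z * b z = (ENNReal.ofReal (w z) ^ (1 / p) * ENNReal.ofReal (w' z) ^ (1 / p')) *
        (a z * b z) := by rw [h1, one_mul]
      _ = _ := by ring

/-! ### Pairing, kernel and boundedness of the Fock projection -/

theorem enorm_pairingIntegrand (α : ℝ) (f g : ℂ → ℂ) (z : ℂ) :
    ‖pairingIntegrand α f g z‖ₑ = (‖f z‖ₑ * gauss (α / 2) z) * (‖g z‖ₑ * gauss (α / 2) z) := by
  rw [pairingIntegrand, enorm_mul, enorm_mul, ← ofReal_norm (E := ℂ) (conj (g z)),
    RCLike.norm_conj, ofReal_norm]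
  have : ‖(Real.exp (-α * ‖z‖ ^ 2) : ℂ)‖ₑ = gauss (α / 2) z * gauss (α / 2) z := by
    rw [← ofReal_norm, Complex.norm_real, Real.norm_of_nonneg (Real.exp_pos _).le, gauss,
      ← ENNReal.ofReal_mul (Real.exp_pos _).le, ← Real.exp_add]
    congr 2; ring
  rw [this]; ring

/-- The reproducing kernel `K_z(y) = e^{α y \bar z}`, up to the factor `α/π`. -/
def kernel (α : ℝ) (z y : ℂ) : ℂ := Complex.exp (α * y * conj z)

theorem norm_kernel (α : ℝ) (z y : ℂ) : ‖kernel α z y‖ = Real.exp (α * (y * conj z).re) := by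
  rw [kernel, Complex.norm_exp, mul_assoc, Complex.re_ofReal_mul]

theorem norm_kernel_le {α : ℝ} (hα : 0 < α) (z y : ℂ) :
    ‖kernel α z y‖ ≤ 1 * Real.exp (α * ‖z‖ * ‖y‖) := by
  rw [norm_kernel, one_mul, Real.exp_le_exp, mul_assoc]
  gcongr
  refine (Complex.re_le_norm _).trans (le_of_eq ?_)
  rw [norm_mul, RCLike.norm_conj, mul_comm]

theorem differentiable_kernel (α : ℝ) (z : ℂ) : Differentiable ℂ (kernel α z) := by
  unfold kernel; fun_prop

/-- The Fock projection. -/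
def proj (α : ℝ) (f : ℂ → ℂ) (z : ℂ) : ℂ := (α / Real.pi : ℝ) * pairing α f (kernel α z)

/-- This is |z-y|² = |z|² + |y|² - 2 Re(y \bar z): the kernel becomes a convolution kernel once the
Gaussian halves are attached. -/
theorem enorm_kernel_mul_gauss (α : ℝ) (z y : ℂ) :
    ‖kernel α z y‖ₑ * gauss (α / 2) y * gauss (α / 2) z = gauss (α / 2) (z - y) := by
  rw [← ofReal_norm, norm_kernel, gauss, gauss, gauss, ← ENNReal.ofReal_mul (Real.exp_pos _).le,
    ← ENNReal.ofReal_mul (by positivity), ← Real.exp_add, ← Real.exp_add]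
  congr 2
  simp only [← Complex.normSq_eq_norm_sq, Complex.normSq_apply, Complex.mul_re, Complex.conj_re,
    Complex.conj_im, Complex.sub_re, Complex.sub_im]
  ring

theorem enorm_proj_mul_gauss_le {α : ℝ} (f : ℂ → ℂ) (z : ℂ) :
    ‖proj α f z‖ₑ * gauss (α / 2) z ≤
      ‖α / Real.pi‖ₑ * ∫⁻ y, gauss (α / 2) (z - y) * (‖f y‖ₑ * gauss (α / 2) y) := by
  have h1 : ‖pairing α f (kernel α z)‖ₑ ≤ ∫⁻ y, ‖pairingIntegrand α f (kernel α z) y‖ₑ :=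
    enorm_integral_le_lintegral_enorm _
  have h0 : ‖((α / Real.pi : ℝ) : ℂ)‖ₑ = ‖α / Real.pi‖ₑ := by
    rw [← ofReal_norm, ← ofReal_norm, Complex.norm_real]
  calc _ ≤ ‖α / Real.pi‖ₑ * (∫⁻ y, ‖pairingIntegrand α f (kernel α z) y‖ₑ) *
        gauss (α / 2) z := by
        rw [proj, enorm_mul, h0]
        gcongr
    _ = _ := by
        rw [mul_assoc, ← lintegral_mul_const' _ _ (gauss_ne_top _ _)]
        congr 2 with y
        rw [enorm_pairingIntegrand, ← enorm_kernel_mul_gauss]; ring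

namespace DualWeights

variable {α p q t : ℝ} {C : ℝ≥0∞} {w w' : ℂ → ℝ}

theorem symm (h : DualWeights α p q t C w w') : DualWeights α q p t C w' w where
  alpha_pos := h.alpha_pos
  pair := h.pair.symm
  aemeasurable := h.aemeasurable'
  aemeasurable' := h.aemeasurable
  ae_pos := by
    filter_upwards [h.ae_pos, h.ae_eq] with z h1 h2
    rw [h2]; positivity
  ae_eq := by
    have hp := h.pair.holderConj.pos
    have hq := h.pair.holderConj.symm.pos
    filter_upwards [h.ae_pos, h.ae_eq] with z h1 h2
    rw [h2, ← Real.rpow_mul h1.le, show -(q / p) * -(p / q) = 1 by field_simp, Real.rpow_one]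

theorem aestronglyMeasurable_volume (h : DualWeights α p q t C w w') {f : ℂ → ℂ}
    (hf : AEStronglyMeasurable f (fockMeasure α p w)) : AEStronglyMeasurable f volume :=
  hf.mono_ac (absolutelyContinuous_fockMeasure h.aemeasurable h.ae_pos α p)

theorem lintegral_enorm_pairingIntegrand_le (h : DualWeights α p q t C w w') {f g : ℂ → ℂ}
    (hf : AEStronglyMeasurable f (fockMeasure α p w))
    (hg : AEStronglyMeasurable g (fockMeasure α q w')) :
    ∫⁻ z, ‖pairingIntegrand α f g z‖ₑ ≤
      eLpNorm f (ENNReal.ofReal p) (fockMeasure α p w) *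
        eLpNorm g (ENNReal.ofReal q) (fockMeasure α q w') := by
  have h1 := (h.aestronglyMeasurable_volume hf).aemeasurable
  have h2 := (h.symm.aestronglyMeasurable_volume hg).aemeasurable
  simp only [enorm_pairingIntegrand]
  rw [eLpNorm_fockMeasure h.aemeasurable h.pair.holderConj.pos,
    eLpNorm_fockMeasure h.aemeasurable' h.pair.holderConj.symm.pos]
  exact h.pair.holder _ _ (by fun_prop) (by fun_prop)

theorem integrable_pairingIntegrand (h : DualWeights α p q t C w w') {f g : ℂ → ℂ}
    (hf : MemLp f (ENNReal.ofReal p) (fockMeasure α p w))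
    (hg : MemLp g (ENNReal.ofReal q) (fockMeasure α q w')) :
    Integrable (pairingIntegrand α f g) := by
  have h1 := h.aestronglyMeasurable_volume hf.1
  have h2 := h.symm.aestronglyMeasurable_volume hg.1
  refine ⟨?_, ?_⟩
  · exact (h1.mul (Complex.continuous_conj.comp_aestronglyMeasurable h2)).mul
      (by fun_prop : Continuous fun z : ℂ =>
        (Real.exp (-α * ‖z‖ ^ 2) : ℂ)).aestronglyMeasurable
  · exact (h.lintegral_enorm_pairingIntegrand_le hf.1 hg.1).trans_lt
      (ENNReal.mul_lt_top hf.2 hg.2)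

theorem norm_pairing_le (h : DualWeights α p q t C w w') {f g : ℂ → ℂ}
    (hf : MemLp f (ENNReal.ofReal p) (fockMeasure α p w))
    (hg : MemLp g (ENNReal.ofReal q) (fockMeasure α q w')) :
    ‖pairing α f g‖ ≤ (eLpNorm f (ENNReal.ofReal p) (fockMeasure α p w)).toReal *
        (eLpNorm g (ENNReal.ofReal q) (fockMeasure α q w')).toReal := by
  rw [← ENNReal.toReal_mul, ← toReal_enorm]
  exact ENNReal.toReal_mono (ENNReal.mul_ne_top hf.2.ne hg.2.ne)
    ((enorm_integral_le_lintegral_enorm _).trans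
      (h.lintegral_enorm_pairingIntegrand_le hf.1 hg.1))

/-- Completing the square gives e^{B|y|} ≤ e^{B²/α} e^{α|y|²/4}, and the remaining Gaussian decay is
integrable for w dA. Kernels and polynomials therefore lie in every space considered here. -/
theorem memLp_exp (h : DualWeights α p q t C w w') (B : ℝ) :
    MemLp (fun y : ℂ => (Real.exp (B * ‖y‖) : ℂ)) (ENNReal.ofReal p) (fockMeasure α p w) := by
  have hp := h.pair.holderConj.pos
  have hα := h.alpha_pos
  refine ⟨(by fun_prop : Continuous _).aestronglyMeasurable, ?_⟩
  rw [eLpNorm_fockMeasure h.aemeasurable hp]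
  refine ENNReal.rpow_lt_top_of_nonneg (by positivity) (ne_of_lt ?_)
  have h1 : ∀ y : ℂ, (‖(Real.exp (B * ‖y‖) : ℂ)‖ₑ * gauss (α / 2) y) ^ p ≤
      ENNReal.ofReal (Real.exp (B ^ 2 / α)) ^ p * gauss (α / 4 * p) y := by
    intro y
    rw [← gauss_rpow _ _ hp.le, ← ENNReal.mul_rpow_of_nonneg _ _ hp.le]
    refine ENNReal.rpow_le_rpow ?_ hp.le
    rw [← ofReal_norm, Complex.norm_real, Real.norm_of_nonneg (Real.exp_pos _).le, gauss, gauss,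
      ← ENNReal.ofReal_mul (Real.exp_pos _).le, ← ENNReal.ofReal_mul (Real.exp_pos _).le,
      ← Real.exp_add, ← Real.exp_add]
    apply ENNReal.ofReal_le_ofReal
    rw [Real.exp_le_exp]
    have e : (2 * B - α * ‖y‖) ^ 2 / (4 * α) =
        B ^ 2 / α - B * ‖y‖ + α / 4 * ‖y‖ ^ 2 := by field_simp; ring
    have : 0 ≤ (2 * B - α * ‖y‖) ^ 2 / (4 * α) := by positivity
    linarith
  refine (lintegral_mono h1).trans_lt ?_
  rw [lintegral_const_mul _ (by fun_prop)]
  exact ENNReal.mul_lt_top (ENNReal.rpow_lt_top_of_nonneg hp.le ENNReal.ofReal_ne_top)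
    (h.pair.lintegral_gauss_lt_top (by positivity))

theorem norm_le_growth {f : ℂ → ℂ} {A B : ℝ}
    (hA : ∀ y, ‖f y‖ ≤ A * Real.exp (B * ‖y‖)) (y : ℂ) :
    ‖f y‖ ≤ ‖(A : ℂ) * (Real.exp (B * ‖y‖) : ℂ)‖ := by
  rw [norm_mul, Complex.norm_real, Complex.norm_real, Real.norm_of_nonneg (Real.exp_pos _).le]
  refine (hA y).trans ?_
  gcongr
  exact Real.le_norm_self A

theorem memLp_of_growth (h : DualWeights α p q t C w w') {f : ℂ → ℂ} {A B : ℝ}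
    (hf : AEStronglyMeasurable f volume) (hA : ∀ y, ‖f y‖ ≤ A * Real.exp (B * ‖y‖)) :
    MemLp f (ENNReal.ofReal p) (fockMeasure α p w) :=
  ((h.memLp_exp B).const_mul (A : ℂ)).mono
    (hf.mono_ac (fockMeasure_absolutelyContinuous _ _ _))
    (Filter.Eventually.of_forall (norm_le_growth hA))

theorem eLpNorm_le_of_growth (h : DualWeights α p q t C w w') {f : ℂ → ℂ} {A B : ℝ}
    (h0 : 0 ≤ A) (hA : ∀ y, ‖f y‖ ≤ A * Real.exp (B * ‖y‖)) :
    (eLpNorm f (ENNReal.ofReal p) (fockMeasure α p w)).toReal ≤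
      A * (eLpNorm (fun y : ℂ => (Real.exp (B * ‖y‖) : ℂ)) (ENNReal.ofReal p)
        (fockMeasure α p w)).toReal := by
  have h1 := eLpNorm_mono (p := ENNReal.ofReal p) (μ := fockMeasure α p w) (norm_le_growth hA)
  have h2 := eLpNorm_const_smul (A : ℂ) (fun y : ℂ => (Real.exp (B * ‖y‖) : ℂ))
    (ENNReal.ofReal p) (fockMeasure α p w)
  rw [show (fun y : ℂ => (A : ℂ) * (Real.exp (B * ‖y‖) : ℂ)) =
    (A : ℂ) • fun y : ℂ => (Real.exp (B * ‖y‖) : ℂ) from rfl, h2] at h1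
  have h3 := ENNReal.toReal_mono (ENNReal.mul_ne_top enorm_ne_top (h.memLp_exp B).2.ne) h1
  rwa [ENNReal.toReal_mul, toReal_enorm, Complex.norm_real, Real.norm_of_nonneg h0] at h3

theorem memLp_kernel (h : DualWeights α p q t C w w') (z : ℂ) :
    MemLp (kernel α z) (ENNReal.ofReal p) (fockMeasure α p w) :=
  h.memLp_of_growth (differentiable_kernel α z).continuous.aestronglyMeasurable
    (norm_kernel_le h.alpha_pos z)

/-- The Fock projection is bounded on the weighted `L^p` space. -/
theorem eLpNorm_proj_le (h : DualWeights α p q t C w w') :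
    ∃ K : ℝ≥0∞, K ≠ ∞ ∧ ∀ f : ℂ → ℂ, AEStronglyMeasurable f (fockMeasure α p w) →
      eLpNorm (proj α f) (ENNReal.ofReal p) (fockMeasure α p w) ≤
        K * eLpNorm f (ENNReal.ofReal p) (fockMeasure α p w) := by
  have hp := h.pair.holderConj.pos
  have hα := h.alpha_pos
  obtain ⟨K, hK, hk⟩ := h.pair.lintegral_conv_rpow_le (c := α / 2) (by positivity)
    (weightMeasure_absolutelyContinuous w)
  refine ⟨‖α / Real.pi‖ₑ * K ^ (1 / p), ENNReal.mul_ne_top enorm_ne_top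
    (ENNReal.rpow_ne_top_of_nonneg (by positivity) hK), fun f hf => ?_⟩
  have h1 := (h.aestronglyMeasurable_volume hf).aemeasurable
  rw [eLpNorm_fockMeasure h.aemeasurable hp, eLpNorm_fockMeasure h.aemeasurable hp]
  have h2 := hk (fun y => ‖f y‖ₑ * gauss (α / 2) y) (by fun_prop)
  calc _ ≤ (∫⁻ z, (‖α / Real.pi‖ₑ *
        ∫⁻ y, gauss (α / 2) (z - y) * (‖f y‖ₑ * gauss (α / 2) y)) ^ p ∂(weightMeasure w)) ^
          (1 / p) := by
        refine ENNReal.rpow_le_rpow (lintegral_mono fun z => ?_) (by positivity)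
        exact ENNReal.rpow_le_rpow (enorm_proj_mul_gauss_le f z) hp.le
    _ = ‖α / Real.pi‖ₑ * (∫⁻ z, (∫⁻ y, gauss (α / 2) (z - y) *
          (‖f y‖ₑ * gauss (α / 2) y)) ^ p ∂(weightMeasure w)) ^ (1 / p) := by
        simp only [ENNReal.mul_rpow_of_nonneg _ _ hp.le]
        rw [lintegral_const_mul' _ _ (ENNReal.rpow_ne_top_of_nonneg hp.le enorm_ne_top),
          ENNReal.mul_rpow_of_nonneg _ _ (by positivity), ← ENNReal.rpow_mul,
          mul_one_div_cancel hp.ne', ENNReal.rpow_one]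
    _ ≤ _ := by
        rw [mul_assoc, ← ENNReal.mul_rpow_of_nonneg _ _ (by positivity)]
        gcongr

end DualWeights

/-! ### The reproducing formula -/

theorem measurePreserving_mul_exp (θ : ℝ) :
    MeasurePreserving fun u : ℂ => Complex.exp (θ * Complex.I) * u := by
  have h := (rotation (Circle.exp θ)).measurePreserving
  convert h using 1
  ext u
  simp [rotation_apply, Circle.coe_exp]

/-- Gaussian mean value property of entire functions. -/
theorem integral_mul_gauss {α : ℝ} (hα : 0 < α) {h : ℂ → ℂ} (hd : Differentiable ℂ h)
    (hi : Integrable fun u : ℂ => h u * (Real.exp (-α * ‖u‖ ^ 2) : ℂ)) :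
    ∫ u, h u * (Real.exp (-α * ‖u‖ ^ 2) : ℂ) = (Real.pi / α : ℝ) * h 0 := by
  set G : ℂ → ℂ := fun u => h u * (Real.exp (-α * ‖u‖ ^ 2) : ℂ)
  set F : ℝ → ℂ → ℂ := fun θ u =>
    h (Complex.exp (θ * Complex.I) * u) * (Real.exp (-α * ‖u‖ ^ 2) : ℂ)
  have hF : ∀ θ : ℝ, F θ = G ∘ fun u : ℂ => Complex.exp (θ * Complex.I) * u := by
    intro θ; ext u
    simp only [F, G, Function.comp, norm_mul, Complex.norm_exp_ofReal_mul_I, one_mul]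
  have hemb : ∀ θ : ℝ, MeasurableEmbedding fun u : ℂ => Complex.exp (θ * Complex.I) * u :=
    fun θ => measurableEmbedding_mulLeft₀ (Complex.exp_ne_zero _)
  have hFint : ∀ θ, Integrable (F θ) := fun θ => by
    rw [hF]; exact (measurePreserving_mul_exp θ).integrable_comp_of_integrable hi
  have hFI : ∀ θ, ∫ u, F θ u = ∫ u, G u := fun θ => by
    rw [hF]; exact (measurePreserving_mul_exp θ).integral_comp (hemb θ) G
  have hFn : ∀ θ, ∫ u, ‖F θ u‖ = ∫ u, ‖G u‖ := fun θ => by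
    rw [hF]
    exact (measurePreserving_mul_exp θ).integral_comp (hemb θ) fun u => ‖G u‖
  have hc : Continuous (Function.uncurry F) := by
    have := hd.continuous
    simp only [F, Function.uncurry_def]
    fun_prop
  have hprod : Integrable (Function.uncurry F)
      ((volume.restrict (Set.Ioc 0 (2 * Real.pi))).prod volume) := by
    rw [integrable_prod_iff hc.aestronglyMeasurable]
    refine ⟨Filter.Eventually.of_forall hFint, ?_⟩
    simp only [Function.uncurry_apply_pair, hFn]
    exact integrable_const _
  -- Integrating first in u gives 2π times the integral sought, by rotation invariance. Integrating
  -- first in θ gives 2π h(0) times the Gaussian, by the mean value property on circles.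
  have hswap := integral_integral_swap hprod
  simp only [hFI] at hswap
  have havg : ∀ u : ℂ, ∫ θ in Set.Ioc 0 (2 * Real.pi), F θ u =
      (2 * Real.pi : ℝ) * (h 0 * (Real.exp (-α * ‖u‖ ^ 2) : ℂ)) := by
    intro u
    have h1 := DiffContOnCl.circleAverage (f := fun v => h (v * u)) (c := 0) (R := 1)
      (Differentiable.diffContOnCl (by fun_prop))
    rw [Real.circleAverage_def] at h1
    simp only [circleMap_zero, Complex.ofReal_one, one_mul, zero_mul] at h1
    rw [intervalIntegral.integral_of_le (by positivity)] at h1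
    simp only [F]
    rw [integral_mul_const, ← h1, Complex.real_smul, ← mul_assoc, ← mul_assoc,
      ← Complex.ofReal_mul, mul_inv_cancel₀ (by positivity), Complex.ofReal_one, one_mul]
  simp only [havg] at hswap
  rw [setIntegral_const, Real.volume_real_Ioc_of_le (by positivity), sub_zero, Complex.real_smul,
    integral_const_mul, integral_const_mul, integral_complex_ofReal,
    GaussianFourier.integral_rexp_neg_mul_sq_norm hα, Complex.finrank_real_complex] at hswap
  have h2 := mul_left_cancel₀ (by exact_mod_cast (by positivity : (2 * Real.pi : ℝ) ≠ 0)) hswap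
  rw [h2, mul_comm]
  norm_num

/-- The translation moves the Gaussian to z: the product of \overline{K_z(z+u)} and e^{-α|z+u|²} is
the entire factor e^{-α \bar z u} times e^{-α|u|²}. The Gaussian mean value property then reproduces
f(z). -/
theorem pairingIntegrand_kernel_add (α : ℝ) (f : ℂ → ℂ) (z u : ℂ) :
    pairingIntegrand α f (kernel α z) (z + u) =
      f (z + u) * Complex.exp (-(α * conj z * u)) * (Real.exp (-α * ‖u‖ ^ 2) : ℂ) := by
  rw [pairingIntegrand, kernel, ← Complex.exp_conj, mul_assoc, mul_assoc, Complex.ofReal_exp,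
    Complex.ofReal_exp, ← Complex.exp_add, mul_assoc (f _), ← Complex.exp_add]
  congr 2
  push_cast
  rw [← Complex.mul_conj', ← Complex.mul_conj']
  simp only [map_mul, map_add, Complex.conj_conj, Complex.conj_ofReal]
  ring

theorem DualWeights.proj_eq_self {α p q t : ℝ} {C : ℝ≥0∞} {w w' : ℂ → ℝ}
    (h : DualWeights α p q t C w w') {f : ℂ → ℂ} (hd : Differentiable ℂ f)
    (hf : MemLp f (ENNReal.ofReal p) (fockMeasure α p w)) (z : ℂ) : proj α f z = f z := by
  have hα := h.alpha_pos
  have h1 := (h.integrable_pairingIntegrand hf (h.symm.memLp_kernel z)).comp_add_left z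
  simp only [pairingIntegrand_kernel_add] at h1
  have h2 := integral_mul_gauss hα (h := fun u => f (z + u) * Complex.exp (-(α * conj z * u)))
    (by fun_prop) h1
  rw [proj, pairing, ← integral_add_left_eq_self _ z]
  simp only [pairingIntegrand_kernel_add]
  rw [h2, ← mul_assoc, ← Complex.ofReal_mul]
  have : α / Real.pi * (Real.pi / α) = 1 := by
    have := Real.pi_ne_zero
    field_simp
  rw [this]
  simp

/-! ### Taylor approximation of the kernel and algebra of the pairing -/

/-- In the tail, a^m ≤ 2^{-N}(2a)^m for m ≥ N. This gives a rate independent of a while the error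
stays of exponential growth, hence summable in the Fock norms. -/
theorem exp_sub_sum_le {a : ℝ} (ha : 0 ≤ a) (N : ℕ) :
    Real.exp a - ∑ m ∈ Finset.range N, a ^ m / m.factorial ≤ (1 / 2) ^ N * Real.exp (2 * a) := by
  have hs := Real.summable_pow_div_factorial a
  have hs2 := Real.summable_pow_div_factorial (2 * a)
  have he : ∀ x : ℝ, Real.exp x = ∑' m : ℕ, x ^ m / m.factorial := fun x => by
    rw [Real.exp_eq_exp_ℝ, NormedSpace.exp_eq_tsum_div]
  have h1 : Real.exp a - ∑ m ∈ Finset.range N, a ^ m / m.factorial =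
      ∑' m : ℕ, a ^ (m + N) / (m + N).factorial := by
    rw [he, ← hs.sum_add_tsum_nat_add N, add_sub_cancel_left]
  have h2 : ∑' m : ℕ, (2 * a) ^ (m + N) / (m + N).factorial ≤ Real.exp (2 * a) := by
    rw [he, ← hs2.sum_add_tsum_nat_add N]
    exact le_add_of_nonneg_left (Finset.sum_nonneg fun m _ => by positivity)
  rw [h1]
  refine le_trans ?_ (mul_le_mul_of_nonneg_left h2 (by positivity))
  rw [← tsum_mul_left]
  refine ((summable_nat_add_iff N).2 hs).tsum_le_tsum (fun m => ?_)
    (((summable_nat_add_iff N).2 hs2).mul_left _)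
  have h3 : (2 * a) ^ (m + N) = 2 ^ N * (2 ^ m * a ^ (m + N)) := by
    rw [mul_pow, pow_add 2]; ring
  rw [h3, mul_div_assoc, ← mul_assoc, ← mul_pow]
  norm_num
  gcongr
  exact le_mul_of_one_le_left (by positivity) (one_le_pow₀ (by norm_num))

theorem norm_exp_sub_sum_le (x : ℂ) (N : ℕ) :
    ‖Complex.exp x - ∑ m ∈ Finset.range N, x ^ m / m.factorial‖ ≤
      (1 / 2) ^ N * Real.exp (2 * ‖x‖) :=
  (Complex.norm_exp_sub_sum_le_exp_norm_sub_sum x N).trans (exp_sub_sum_le (norm_nonneg x) N)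

/-- The polynomial function with the first `N` coefficients given by `c`. -/
def polyFun (c : ℕ → ℂ) (N : ℕ) (z : ℂ) : ℂ := ∑ n ∈ Finset.range N, c n * z ^ n

theorem differentiable_polyFun (c : ℕ → ℂ) (N : ℕ) : Differentiable ℂ (polyFun c N) := by
  unfold polyFun; fun_prop

/-- The Taylor coefficients of `kernel α z`. -/
def kernelCoeff (α : ℝ) (z : ℂ) (n : ℕ) : ℂ := (α * conj z) ^ n / n.factorial

theorem norm_kernel_sub_polyFun_le {α : ℝ} (hα : 0 < α) (z y : ℂ) (N : ℕ) :
    ‖kernel α z y - polyFun (kernelCoeff α z) N y‖ ≤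
      (1 / 2) ^ N * Real.exp (2 * α * ‖z‖ * ‖y‖) := by
  have h1 := norm_exp_sub_sum_le (α * y * conj z) N
  have h2 : ‖(α * y * conj z : ℂ)‖ = α * ‖z‖ * ‖y‖ := by
    rw [norm_mul, norm_mul, RCLike.norm_conj, Complex.norm_real, Real.norm_of_nonneg hα.le]; ring
  rw [h2] at h1
  convert h1 using 2
  · rw [kernel, polyFun]
    congr 2
    ext n
    rw [kernelCoeff]
    simp only [mul_pow]
    ring
  · congr 1; ring

theorem norm_pairing_le_of_support {α R b : ℝ} {f g : ℂ → ℂ} (hf : ∀ z, R < ‖z‖ → f z = 0)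
    (hg : ∀ z, ‖z‖ ≤ R → ‖g z‖ ≤ b) (hi : Integrable (pairingIntegrand α f fun _ => 1)) :
    ‖pairing α f g‖ ≤ b * ∫ z, ‖pairingIntegrand α f (fun _ => 1) z‖ := by
  rw [← integral_const_mul]
  refine norm_integral_le_of_norm_le (hi.norm.const_mul b) (Filter.Eventually.of_forall fun z => ?_)
  rcases le_or_gt ‖z‖ R with hz | hz
  · simp only [pairingIntegrand, norm_mul, RCLike.norm_conj, map_one, mul_one]
    calc _ = ‖g z‖ * (‖f z‖ * ‖(Real.exp (-α * ‖z‖ ^ 2) : ℂ)‖) := by ring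
      _ ≤ _ := by gcongr; exact hg z hz
  · simp [pairingIntegrand, hf z hz]

theorem pairing_sub_right {α : ℝ} {f g₁ g₂ : ℂ → ℂ} (h₁ : Integrable (pairingIntegrand α f g₁))
    (h₂ : Integrable (pairingIntegrand α f g₂)) :
    pairing α f (fun z => g₁ z - g₂ z) = pairing α f g₁ - pairing α f g₂ := by
  simp only [pairing]
  rw [← integral_sub h₁ h₂]
  congr 1 with z
  simp only [pairingIntegrand, map_sub]; ring

theorem pairing_add_right {α : ℝ} {f g₁ g₂ : ℂ → ℂ} (h₁ : Integrable (pairingIntegrand α f g₁))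
    (h₂ : Integrable (pairingIntegrand α f g₂)) :
    pairing α f (fun z => g₁ z + g₂ z) = pairing α f g₁ + pairing α f g₂ := by
  simp only [pairing]
  rw [← integral_add h₁ h₂]
  congr 1 with z
  simp only [pairingIntegrand, map_add]; ring

theorem pairing_add_left {α : ℝ} {f₁ f₂ g : ℂ → ℂ} (h₁ : Integrable (pairingIntegrand α f₁ g))
    (h₂ : Integrable (pairingIntegrand α f₂ g)) :
    pairing α (fun z => f₁ z + f₂ z) g = pairing α f₁ g + pairing α f₂ g := by
  simp only [pairing]
  rw [← integral_add h₁ h₂]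
  congr 1 with z
  simp only [pairingIntegrand]; ring

theorem pairing_sub_left {α : ℝ} {f₁ f₂ g : ℂ → ℂ} (h₁ : Integrable (pairingIntegrand α f₁ g))
    (h₂ : Integrable (pairingIntegrand α f₂ g)) :
    pairing α (fun z => f₁ z - f₂ z) g = pairing α f₁ g - pairing α f₂ g := by
  simp only [pairing]
  rw [← integral_sub h₁ h₂]
  congr 1 with z
  simp only [pairingIntegrand]; ring

theorem pairing_const_mul_left (α : ℝ) (c : ℂ) (f g : ℂ → ℂ) :
    pairing α (fun z => c * f z) g = c * pairing α f g := by
  simp only [pairing]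
  rw [← integral_const_mul]
  congr 1 with z
  simp only [pairingIntegrand]; ring

theorem pairing_const_mul_right (α : ℝ) (c : ℂ) (f g : ℂ → ℂ) :
    pairing α f (fun z => c * g z) = conj c * pairing α f g := by
  simp only [pairing]
  rw [← integral_const_mul]
  congr 1 with z
  simp only [pairingIntegrand, map_mul]; ring

theorem pairing_polyFun {α : ℝ} {f : ℂ → ℂ} (c : ℕ → ℂ) (N : ℕ)
    (hi : ∀ n : ℕ, Integrable (pairingIntegrand α f fun z => z ^ n)) :
    pairing α f (polyFun c N) =
      ∑ n ∈ Finset.range N, conj (c n) * pairing α f (fun z => z ^ n) := by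
  simp only [pairing, ← integral_const_mul]
  rw [← integral_finsetSum _ fun n _ => (hi n).const_mul _]
  congr 1 with z
  simp only [pairingIntegrand, polyFun, map_sum, map_mul, Finset.mul_sum, Finset.sum_mul]
  exact Finset.sum_congr rfl fun n _ => by ring

theorem pairing_conj_symm (α : ℝ) (f g : ℂ → ℂ) : conj (pairing α f g) = pairing α g f := by
  simp only [pairing]
  rw [← integral_conj]
  congr 1 with z
  simp only [pairingIntegrand, map_mul, Complex.conj_conj, Complex.conj_ofReal]
  ring

theorem tendsto_half_pow_mul (b : ℝ) :
    Filter.Tendsto (fun N : ℕ => (1 / 2 : ℝ) ^ N * b) Filter.atTop (nhds 0) := by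
  simpa using (tendsto_pow_atTop_nhds_zero_of_lt_one (by norm_num : (0 : ℝ) ≤ 1 / 2)
    (by norm_num)).mul_const b

theorem differentiable_of_approx {g : ℂ → ℂ} {G : ℕ → ℂ → ℂ} (hG : ∀ N, Differentiable ℂ (G N))
    (b : ℝ → ℝ) (h : ∀ N R z, ‖z‖ ≤ R → ‖g z - G N z‖ ≤ (1 / 2) ^ N * b R) :
    Differentiable ℂ g := by
  have hT : TendstoLocallyUniformlyOn G g Filter.atTop Set.univ := by
    rw [tendstoLocallyUniformlyOn_iff_forall_isCompact isOpen_univ]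
    intro K _ hK
    obtain ⟨R, hR⟩ := hK.isBounded.subset_closedBall 0
    rw [Metric.tendstoUniformlyOn_iff]
    intro ε hε
    filter_upwards [(tendsto_half_pow_mul (b R)).eventually (gt_mem_nhds hε)] with N hN z hz
    rw [dist_eq_norm]
    exact (h N R z (by simpa using hR hz)).trans_lt hN
  exact differentiableOn_univ.1 (hT.differentiableOn
    (Filter.Eventually.of_forall fun N => (hG N).differentiableOn) isOpen_univ)

/-! ### The converse of Hölder's inequality -/

theorem lintegral_weightMeasure_eq {w : ℂ → ℝ} (hw : AEMeasurable w) (F : ℂ → ℝ≥0∞) :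
    ∫⁻ z, F z ∂(weightMeasure w) = ∫⁻ z, ENNReal.ofReal (w z) * F z := by
  rw [weightMeasure, lintegral_withDensity_eq_lintegral_mul_non_measurable₀ _ hw.ennreal_ofReal
    (Filter.Eventually.of_forall fun z => ENNReal.ofReal_lt_top)]
  rfl

theorem enorm_mul_gauss (g : ℂ → ℂ) (c : ℝ) (z : ℂ) :
    ‖g z‖ₑ * gauss c z = ENNReal.ofReal (‖g z‖ * Real.exp (-c * ‖z‖ ^ 2)) := by
  rw [gauss, ENNReal.ofReal_mul (norm_nonneg _), ofReal_norm]

namespace DualWeights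

variable {α p q t : ℝ} {C : ℝ≥0∞} {w w' : ℂ → ℝ}

/-- The function for which Hölder's inequality against `g` is an equality. -/
theorem exists_extremal (h : DualWeights α p q t C w w') {g : ℂ → ℂ}
    (hg : MemLp g (ENNReal.ofReal q) (fockMeasure α q w')) :
    ∃ f : ℂ → ℂ, MemLp f (ENNReal.ofReal p) (fockMeasure α p w) ∧ (∀ z, g z = 0 → f z = 0) ∧
      pairing α f g =
        ((∫⁻ z, (‖g z‖ₑ * gauss (α / 2) z) ^ q ∂(weightMeasure w')).toReal : ℂ) ∧
      eLpNorm f (ENNReal.ofReal p) (fockMeasure α p w) =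
        (∫⁻ z, (‖g z‖ₑ * gauss (α / 2) z) ^ q ∂(weightMeasure w')) ^ (1 / p) := by
  have hpq := h.pair.holderConj
  have hp := hpq.pos
  have hq := hpq.symm.pos
  have hq1 := hpq.symm.lt
  have hw := h.aemeasurable
  have hw' := h.aemeasurable'
  have hgm := (h.symm.aestronglyMeasurable_volume hg.1)
  set I := ∫⁻ z, (‖g z‖ₑ * gauss (α / 2) z) ^ q ∂(weightMeasure w')
  have hI : I ≠ ∞ := by
    have h1 := hg.2
    rw [eLpNorm_fockMeasure hw' hq] at h1
    intro h2
    rw [show (∫⁻ z, (‖g z‖ₑ * gauss (α / 2) z) ^ q ∂(weightMeasure w')) = ∞ from h2,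
      ENNReal.top_rpow_of_pos (by positivity)] at h1
    exact lt_irrefl _ h1
  set x : ℂ → ℝ := fun z => ‖g z‖ * Real.exp (-(α / 2) * ‖z‖ ^ 2)
  have hx : ∀ z, 0 ≤ x z := fun z => by positivity
  -- The Gaussian factor is chosen so that f \bar g e^{-α|z|²} = w' x^q and |f| e^{-α|z|²/2} = w'
  -- x^{q-1}. The norms match because (q-1)p = q and w w'^p = w'.
  set r : ℂ → ℝ := fun z =>
    w' z * (‖g z‖ ^ (q - 2) * Real.exp ((α - q * α / 2) * ‖z‖ ^ 2))
  set f : ℂ → ℂ := fun z => r z * g z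
  have hrm : AEMeasurable r := by
    have h1 : AEMeasurable fun z => ‖g z‖ ^ (q - 2) := hgm.aemeasurable.norm.pow_const _
    have h2 : AEMeasurable fun z : ℂ => Real.exp ((α - q * α / 2) * ‖z‖ ^ 2) :=
      Measurable.aemeasurable (by fun_prop)
    exact hw'.mul (h1.mul h2)
  have hfm : AEStronglyMeasurable f volume :=
    (Complex.continuous_ofReal.comp_aestronglyMeasurable hrm.aestronglyMeasurable).mul hgm
  have hI' : I = ∫⁻ z, ENNReal.ofReal (w' z * x z ^ q) := by
    simp only [I, lintegral_weightMeasure_eq hw']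
    refine lintegral_congr_ae ?_
    filter_upwards [h.symm.ae_pos] with z hz
    rw [enorm_mul_gauss, ENNReal.ofReal_rpow_of_nonneg (hx z) hq.le,
      ENNReal.ofReal_mul hz.le]
  have hpow : ∀ z, ‖g z‖ ^ (q - 2) * ‖g z‖ = ‖g z‖ ^ (q - 1) := by
    intro z
    rcases (norm_nonneg (g z)).eq_or_lt with h0 | h0
    · rw [← h0, mul_zero, Real.zero_rpow (by linarith)]
    · rw [← Real.rpow_add_one h0.ne']; congr 1; ring
  have hpow' : ∀ z, ‖g z‖ ^ (q - 1) * ‖g z‖ = ‖g z‖ ^ q := by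
    intro z
    rcases (norm_nonneg (g z)).eq_or_lt with h0 | h0
    · rw [← h0, mul_zero, Real.zero_rpow (by linarith)]
    · rw [← Real.rpow_add_one h0.ne']; congr 1; ring
  have hxpow : ∀ z (s : ℝ), x z ^ s = ‖g z‖ ^ s * Real.exp (-(s * α / 2) * ‖z‖ ^ 2) := by
    intro z s
    simp only [x]
    rw [Real.mul_rpow (norm_nonneg _) (Real.exp_pos _).le, ← Real.exp_mul]
    congr 2; ring
  have hpair : ∀ z, pairingIntegrand α f g z = ((w' z * x z ^ q : ℝ) : ℂ) := by
    intro z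
    have e1 : g z * conj (g z) = ((‖g z‖ * ‖g z‖ : ℝ) : ℂ) := by
      rw [Complex.mul_conj', ← pow_two]; push_cast; rfl
    calc pairingIntegrand α f g z
        = (r z : ℂ) * (g z * conj (g z)) * (Real.exp (-α * ‖z‖ ^ 2) : ℂ) := by
          simp only [pairingIntegrand, f]; ring
      _ = ((r z * (‖g z‖ * ‖g z‖) * Real.exp (-α * ‖z‖ ^ 2) : ℝ) : ℂ) := by
          rw [e1]; push_cast; rfl
      _ = _ := by
          congr 1
          rw [hxpow, ← hpow', ← hpow]
          have : Real.exp (-(q * α / 2) * ‖z‖ ^ 2) =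
              Real.exp ((α - q * α / 2) * ‖z‖ ^ 2) * Real.exp (-α * ‖z‖ ^ 2) := by
            rw [← Real.exp_add]; congr 1; ring
          rw [this]
          simp only [r]; ring
  have hnorm : ∫⁻ z, (‖f z‖ₑ * gauss (α / 2) z) ^ p ∂(weightMeasure w) = I := by
    rw [hI', lintegral_weightMeasure_eq hw]
    refine lintegral_congr_ae ?_
    filter_upwards [h.ae_pos, h.ae_eq, h.symm.ae_pos] with z h1 h2 h3
    have e1 : ‖f z‖ * Real.exp (-(α / 2) * ‖z‖ ^ 2) = w' z * x z ^ (q - 1) := by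
      have : ‖f z‖ = w' z * ‖g z‖ ^ (q - 1) * Real.exp ((α - q * α / 2) * ‖z‖ ^ 2) := by
        simp only [f]
        rw [norm_mul, Complex.norm_real, Real.norm_of_nonneg (by positivity), ← hpow]
        simp only [r]; ring
      rw [this, hxpow, mul_assoc, ← Real.exp_add, ← mul_assoc]
      congr 2; ring
    rw [enorm_mul_gauss, e1, ENNReal.ofReal_rpow_of_nonneg (by positivity) hp.le,
      ← ENNReal.ofReal_mul h1.le, Real.mul_rpow h3.le (by positivity), ← Real.rpow_mul (hx z)]
    congr 1
    have e2 : (q - 1) * p = q := by have := hpq.mul_eq_add; linarith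
    have e3 : w z * w' z ^ p = w' z := by
      rw [h2, ← Real.rpow_mul h1.le]
      nth_rewrite 1 [← Real.rpow_one (w z)]
      rw [← Real.rpow_add h1]
      congr 1
      have := hpq.mul_eq_add
      field_simp
      linarith
    rw [e2, ← mul_assoc, e3]
  have he : eLpNorm f (ENNReal.ofReal p) (fockMeasure α p w) = I ^ (1 / p) := by
    rw [eLpNorm_fockMeasure hw hp, hnorm]
  refine ⟨f, ⟨hfm.mono_ac (fockMeasure_absolutelyContinuous _ _ _), ?_⟩, ?_, ?_, he⟩
  · rw [he]; exact ENNReal.rpow_lt_top_of_nonneg (by positivity) hI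
  · intro z hz; simp [f, hz]
  · simp only [pairing, hpair]
    rw [integral_complex_ofReal, hI', integral_eq_lintegral_of_nonneg_ae]
    · filter_upwards [h.symm.ae_pos] with z h3
      exact mul_nonneg h3.le (Real.rpow_nonneg (hx z) _)
    · have : AEMeasurable x := hgm.aemeasurable.norm.mul (Measurable.aemeasurable (by fun_prop))
      exact (hw'.mul (this.pow_const _)).aestronglyMeasurable

/-- For the extremal f the hypothesis reads I ≤ B I^{1/p}, that is, I^{1/q} ≤ B. Testing only with f
that vanish where g does lets a truncated g be tested with compactly supported functions. -/
theorem eLpNorm_le_of_extremal (h : DualWeights α p q t C w w') {g : ℂ → ℂ}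
    (hg : MemLp g (ENNReal.ofReal q) (fockMeasure α q w')) {B : ℝ} (hB : 0 ≤ B)
    (hb : ∀ f : ℂ → ℂ, MemLp f (ENNReal.ofReal p) (fockMeasure α p w) →
      (∀ z, g z = 0 → f z = 0) → ‖pairing α f g‖ ≤
        B * (eLpNorm f (ENNReal.ofReal p) (fockMeasure α p w)).toReal) :
    eLpNorm g (ENNReal.ofReal q) (fockMeasure α q w') ≤ ENNReal.ofReal B := by
  have hpq := h.pair.holderConj
  have hp := hpq.pos
  have hq := hpq.symm.pos
  obtain ⟨f, hf, hs, hfg, hn⟩ := h.exists_extremal hg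
  have h1 := hb f hf hs
  rw [hfg, hn, Complex.norm_real, Real.norm_of_nonneg ENNReal.toReal_nonneg,
    ← ENNReal.toReal_rpow] at h1
  have h2 : eLpNorm g (ENNReal.ofReal q) (fockMeasure α q w') ≠ ∞ := hg.2.ne
  rw [← ENNReal.ofReal_toReal h2]
  apply ENNReal.ofReal_le_ofReal
  rw [eLpNorm_fockMeasure h.aemeasurable' hq, ← ENNReal.toReal_rpow]
  set I := (∫⁻ z, (‖g z‖ₑ * gauss (α / 2) z) ^ q ∂(weightMeasure w')).toReal
  have hI : 0 ≤ I := ENNReal.toReal_nonneg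
  rcases hI.eq_or_lt with h0 | h0
  · rw [← h0, Real.zero_rpow (by positivity)]; exact hB
  · have h3 : I = I ^ (1 / q) * I ^ (1 / p) := by
      rw [← Real.rpow_add h0, one_div, one_div, hpq.symm.inv_add_inv_eq_one, Real.rpow_one]
    nth_rewrite 1 [h3] at h1
    exact le_of_mul_le_mul_right h1 (by positivity)

/-- Without prior knowledge that g has finite norm, the extremal function is available only for its
truncations to balls; Fatou's lemma passes to g. -/
theorem eLpNorm_le_of_continuous (h : DualWeights α p q t C w w') {g : ℂ → ℂ}
    (hg : Continuous g) {B : ℝ} (hB : 0 ≤ B)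
    (hb : ∀ (R : ℝ) (f : ℂ → ℂ), MemLp f (ENNReal.ofReal p) (fockMeasure α p w) →
      (∀ z, R < ‖z‖ → f z = 0) → ‖pairing α f g‖ ≤
        B * (eLpNorm f (ENNReal.ofReal p) (fockMeasure α p w)).toReal) :
    eLpNorm g (ENNReal.ofReal q) (fockMeasure α q w') ≤ ENNReal.ofReal B := by
  set G : ℕ → ℂ → ℂ := fun n => (Metric.closedBall (0 : ℂ) n).indicator g
  have hGm : ∀ n, Measurable (G n) := fun n => hg.measurable.indicator measurableSet_closedBall
  have hn : ∀ n, eLpNorm (G n) (ENNReal.ofReal q) (fockMeasure α q w') ≤ ENNReal.ofReal B := by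
    intro n
    obtain ⟨A, hA⟩ := (isCompact_closedBall (0 : ℂ) (n : ℝ)).exists_bound_of_continuousOn
      hg.continuousOn
    have hmem : MemLp (G n) (ENNReal.ofReal q) (fockMeasure α q w') := by
      refine h.symm.memLp_of_growth (A := max A 0) (B := 0)
        (hGm n).aestronglyMeasurable fun y => ?_
      by_cases hy : y ∈ Metric.closedBall (0 : ℂ) n
      · simp only [G, Set.indicator_of_mem hy]
        simpa using Or.inl (hA y hy)
      · simp [G, Set.indicator_of_notMem hy]
    refine h.eLpNorm_le_of_extremal hmem hB fun f hf hs => ?_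
    have hs' : ∀ z, z ∉ Metric.closedBall (0 : ℂ) n → f z = 0 := fun z hz =>
      hs z (Set.indicator_of_notMem hz _)
    have : pairing α f (G n) = pairing α f g := by
      simp only [pairing]
      congr 1 with z
      by_cases hz : z ∈ Metric.closedBall (0 : ℂ) n
      · simp only [pairingIntegrand, G, Set.indicator_of_mem hz]
      · simp [pairingIntegrand, hs' z hz]
    rw [this]
    exact hb n f hf fun z hz => hs' z (by simpa using hz)
  refine (Lp.eLpNorm_lim_le_liminf_eLpNorm (fun n => (hGm n).aestronglyMeasurable) g
    (Filter.Eventually.of_forall fun z => ?_)).trans ?_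
  · refine tendsto_const_nhds.congr' ?_
    filter_upwards [Filter.eventually_ge_atTop ⌈‖z‖⌉₊] with n hn
    have hz : z ∈ Metric.closedBall (0 : ℂ) n := by
      simpa using Nat.ceil_le.1 hn
    simp only [G, Set.indicator_of_mem hz]
  · exact (Filter.liminf_le_liminf (Filter.Eventually.of_forall hn)).trans (by simp)

theorem tendsto_eLpNorm_indicator_compl (h : DualWeights α p q t C w w') {f : ℂ → ℂ}
    (hf : MemLp f (ENNReal.ofReal p) (fockMeasure α p w)) :
    Filter.Tendsto (fun n : ℕ => (eLpNorm ((Metric.closedBall (0 : ℂ) n)ᶜ.indicator f)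
      (ENNReal.ofReal p) (fockMeasure α p w)).toReal) Filter.atTop (nhds 0) := by
  have hp := h.pair.holderConj.pos
  have hp0 : ENNReal.ofReal p ≠ 0 := by simpa using hp
  rw [← ENNReal.toReal_zero]
  refine (ENNReal.tendsto_toReal ENNReal.zero_ne_top).comp ?_
  simp only [eLpNorm_eq_lintegral_rpow_enorm_toReal hp0 ENNReal.ofReal_ne_top,
    ENNReal.toReal_ofReal hp.le]
  have h0 : (0 : ℝ≥0∞) = 0 ^ (1 / p) := (ENNReal.zero_rpow_of_pos (by positivity)).symm
  rw [h0]
  refine (ENNReal.continuous_rpow_const.tendsto _).comp ?_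
  have h1 : Filter.Tendsto (fun n : ℕ => ∫⁻ z,
      ‖(Metric.closedBall (0 : ℂ) n)ᶜ.indicator f z‖ₑ ^ p ∂(fockMeasure α p w)) Filter.atTop
      (nhds (∫⁻ _, 0 ∂(fockMeasure α p w))) := by
    refine tendsto_lintegral_of_dominated_convergence' (fun z => ‖f z‖ₑ ^ p) (fun n => ?_)
      (fun n => Filter.Eventually.of_forall fun z => ?_) ?_
      (Filter.Eventually.of_forall fun z => ?_)
    · exact (hf.1.indicator measurableSet_closedBall.compl).enorm.pow_const _
    · exact ENNReal.rpow_le_rpow (enorm_indicator_le_enorm_self f z) hp.le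
    · have := lintegral_rpow_enorm_lt_top_of_eLpNorm_lt_top hp0 ENNReal.ofReal_ne_top hf.2
      rw [ENNReal.toReal_ofReal hp.le] at this
      exact this.ne
    · refine tendsto_const_nhds.congr' ?_
      filter_upwards [Filter.eventually_ge_atTop ⌈‖z‖⌉₊] with n hn
      have hz : z ∈ Metric.closedBall (0 : ℂ) n := by
        simpa using Nat.ceil_le.1 hn
      rw [Set.indicator_of_notMem (by simpa using hz), enorm_zero, ENNReal.zero_rpow_of_pos hp]
  simpa using h1

end DualWeights

/-! ### Kernels, polynomials and projections as elements of the Fock space -/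

namespace FockSpace

variable {α p : ℝ} {w : ℂ → ℝ}

/-- The element of the Fock space given by an entire function in `L^p`. -/
def ofMemLp (f : ℂ → ℂ) (hd : Differentiable ℂ f)
    (hf : MemLp f (ENNReal.ofReal p) (fockMeasure α p w)) : FockSpace α p w :=
  (⟨f, hd, hf⟩ : fockSubmodule α p w)

theorem differentiable (f : FockSpace α p w) : Differentiable ℂ f := f.2.1

theorem norm_eq [Fact (1 < p)] (f : FockSpace α p w) :
    ‖f‖ = (eLpNorm f (ENNReal.ofReal p) (fockMeasure α p w)).toReal := rfl

/-- Evaluation at a point. -/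
def eval (z : ℂ) : FockSpace α p w →ₗ[ℂ] ℂ where
  toFun f := f z
  map_add' _ _ := rfl
  map_smul' _ _ := rfl

theorem ext {f g : FockSpace α p w} (hfg : ∀ z, f z = g z) : f = g :=
  Subtype.ext (funext hfg)

end FockSpace

namespace DualWeights

variable {α p q t : ℝ} {C : ℝ≥0∞} {w w' : ℂ → ℝ}

theorem memLp_pow (h : DualWeights α p q t C w w') (n : ℕ) :
    MemLp (fun z : ℂ => z ^ n) (ENNReal.ofReal p) (fockMeasure α p w) := by
  refine h.memLp_of_growth (A := n.factorial) (B := 1)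
    (by fun_prop : Continuous _).aestronglyMeasurable fun y => ?_
  have := Real.pow_div_factorial_le_exp ‖y‖ (norm_nonneg y) n
  rw [norm_pow, one_mul, mul_comm]
  rwa [div_le_iff₀ (by positivity)] at this

/-- The monomial `z ^ n`. -/
def mono (h : DualWeights α p q t C w w') (n : ℕ) : FockSpace α p w :=
  .ofMemLp (fun z => z ^ n) (by fun_prop) (h.memLp_pow n)

/-- The kernel as an element of the Fock space. -/
def kernelElem (h : DualWeights α p q t C w w') (z : ℂ) : FockSpace α p w :=
  .ofMemLp (kernel α z) (differentiable_kernel α z) (h.memLp_kernel z)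

/-- A polynomial as an element of the Fock space. -/
def polyElem (h : DualWeights α p q t C w w') (c : ℕ → ℂ) (N : ℕ) : FockSpace α p w :=
  ∑ n ∈ Finset.range N, c n • h.mono n

theorem polyElem_apply (h : DualWeights α p q t C w w') (c : ℕ → ℂ) (N : ℕ) (z : ℂ) :
    h.polyElem c N z = polyFun c N z := by
  change FockSpace.eval z (h.polyElem c N) = _
  rw [polyElem, map_sum]
  rfl

theorem memLp_polyFun (h : DualWeights α p q t C w w') (c : ℕ → ℂ) (N : ℕ) :
    MemLp (polyFun c N) (ENNReal.ofReal p) (fockMeasure α p w) := by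
  rw [show polyFun c N = h.polyElem c N from funext fun z => (h.polyElem_apply c N z).symm]
  exact (h.polyElem c N).memLp

/-- The norm of `e^{B|z|}`. -/
def expNorm (_ : DualWeights α p q t C w w') (B : ℝ) : ℝ :=
  (eLpNorm (fun y : ℂ => (Real.exp (B * ‖y‖) : ℂ)) (ENNReal.ofReal p) (fockMeasure α p w)).toReal

theorem norm_sub_le_of_growth [Fact (1 < p)] (h : DualWeights α p q t C w w')
    (f g : FockSpace α p w) {A B : ℝ} (hA : 0 ≤ A)
    (hfg : ∀ y, ‖f y - g y‖ ≤ A * Real.exp (B * ‖y‖)) : ‖f - g‖ ≤ A * h.expNorm B :=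
  h.eLpNorm_le_of_growth hA hfg

/-- The coefficients of the Fock projection of a function of compact support. -/
def projCoeff (α : ℝ) (f : ℂ → ℂ) (n : ℕ) : ℂ :=
  (α / Real.pi : ℝ) * (α ^ n / n.factorial) * pairing α f (fun z => z ^ n)

theorem polyFun_projCoeff (h : DualWeights α p q t C w w') {f : ℂ → ℂ}
    (hf : MemLp f (ENNReal.ofReal p) (fockMeasure α p w)) (N : ℕ) (y : ℂ) :
    polyFun (projCoeff α f) N y =
      (α / Real.pi : ℝ) * pairing α f (polyFun (kernelCoeff α y) N) := by
  rw [pairing_polyFun _ _ fun n => h.integrable_pairingIntegrand hf (h.symm.memLp_pow n), polyFun,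
    Finset.mul_sum]
  refine Finset.sum_congr rfl fun n _ => ?_
  simp only [projCoeff, kernelCoeff, map_div₀, map_pow, map_mul, Complex.conj_conj,
    Complex.conj_ofReal, map_natCast, mul_pow]
  ring

theorem memLp_one (h : DualWeights α p q t C w w') :
    MemLp (fun _ : ℂ => (1 : ℂ)) (ENNReal.ofReal p) (fockMeasure α p w) := by
  simpa using h.memLp_pow 0

/-- On the support of f the kernel error has growth at most e^{2αR|y|}. Thus the Taylor polynomials
of Pf converge to it in the Fock norm as well as locally uniformly. -/
theorem norm_proj_sub_le (h : DualWeights α p q t C w w') {f : ℂ → ℂ}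
    (hf : MemLp f (ENNReal.ofReal p) (fockMeasure α p w)) {R : ℝ}
    (hs : ∀ z, R < ‖z‖ → f z = 0) (N : ℕ) (y : ℂ) :
    ‖proj α f y - polyFun (projCoeff α f) N y‖ ≤
      (1 / 2) ^ N * (α / Real.pi * ∫ z, ‖pairingIntegrand α f (fun _ => 1) z‖) *
        Real.exp (2 * α * R * ‖y‖) := by
  have hα := h.alpha_pos
  have hπ := Real.pi_pos
  rw [h.polyFun_projCoeff hf, proj, ← mul_sub, ← pairing_sub_right
    (h.integrable_pairingIntegrand hf (h.symm.memLp_kernel y))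
    (h.integrable_pairingIntegrand hf (h.symm.memLp_polyFun _ N)), norm_mul, Complex.norm_real,
    Real.norm_of_nonneg (by positivity)]
  have h1 := norm_pairing_le_of_support (α := α) (b := (1 / 2) ^ N * Real.exp (2 * α * R * ‖y‖))
    (g := fun z => kernel α y z - polyFun (kernelCoeff α y) N z) hs (fun z hz => ?_)
    (h.integrable_pairingIntegrand hf h.symm.memLp_one)
  · calc _ ≤ α / Real.pi * ((1 / 2) ^ N * Real.exp (2 * α * R * ‖y‖) *
          ∫ z, ‖pairingIntegrand α f (fun _ => 1) z‖) := by gcongr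
      _ = _ := by ring
  · refine (norm_kernel_sub_polyFun_le hα y z N).trans ?_
    gcongr ?_ * Real.exp ?_
    calc 2 * α * ‖y‖ * ‖z‖ ≤ 2 * α * ‖y‖ * R := by gcongr
      _ = _ := by ring

theorem differentiable_proj (h : DualWeights α p q t C w w') {f : ℂ → ℂ}
    (hf : MemLp f (ENNReal.ofReal p) (fockMeasure α p w)) {R : ℝ}
    (hs : ∀ z, R < ‖z‖ → f z = 0) : Differentiable ℂ (proj α f) := by
  have hα := h.alpha_pos
  refine differentiable_of_approx (differentiable_polyFun (projCoeff α f))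
    (fun r => (α / Real.pi * ∫ z, ‖pairingIntegrand α f (fun _ => 1) z‖) *
      Real.exp (2 * α * |R| * r)) fun N r z hz => ?_
  refine (h.norm_proj_sub_le hf hs N z).trans ?_
  rw [mul_assoc]
  gcongr
  exact le_abs_self R

theorem memLp_proj (h : DualWeights α p q t C w w') {f : ℂ → ℂ}
    (hf : MemLp f (ENNReal.ofReal p) (fockMeasure α p w)) {R : ℝ}
    (hs : ∀ z, R < ‖z‖ → f z = 0) :
    MemLp (proj α f) (ENNReal.ofReal p) (fockMeasure α p w) := by
  refine h.memLp_of_growth (A := α / Real.pi * ∫ z, ‖pairingIntegrand α f (fun _ => 1) z‖)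
    (B := 2 * α * R) (h.differentiable_proj hf hs).continuous.aestronglyMeasurable fun y => ?_
  -- For N = 0 the polynomial is empty and the estimate is a growth bound for Pf itself.
  simpa [polyFun] using h.norm_proj_sub_le hf hs 0 y

/-- The Fock projection of a function of compact support, as an element of the Fock space. -/
def projElem (h : DualWeights α p q t C w w') {f : ℂ → ℂ}
    (hf : MemLp f (ENNReal.ofReal p) (fockMeasure α p w)) {R : ℝ}
    (hs : ∀ z, R < ‖z‖ → f z = 0) : FockSpace α p w :=
  .ofMemLp (proj α f) (h.differentiable_proj hf hs) (h.memLp_proj hf hs)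

/-- This is for the representing function before its norm is known to be finite: its continuity
suffices against compactly supported f. -/
theorem integrable_pairingIntegrand_of_support (h : DualWeights α p q t C w w') {f g : ℂ → ℂ}
    (hf : MemLp f (ENNReal.ofReal p) (fockMeasure α p w)) {R : ℝ}
    (hs : ∀ z, R < ‖z‖ → f z = 0) (hg : Continuous g) :
    Integrable (pairingIntegrand α f g) := by
  obtain ⟨A, hA⟩ := (isCompact_closedBall (0 : ℂ) R).exists_bound_of_continuousOn hg.continuousOn
  have h1 := h.integrable_pairingIntegrand hf h.symm.memLp_one
  refine (h1.norm.const_mul A).mono' ?_ (Filter.Eventually.of_forall fun z => ?_)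
  · exact ((h.aestronglyMeasurable_volume hf.1).mul
      (Complex.continuous_conj.comp hg).aestronglyMeasurable).mul
      (by fun_prop : Continuous fun z : ℂ =>
        (Real.exp (-α * ‖z‖ ^ 2) : ℂ)).aestronglyMeasurable
  · rcases le_or_gt ‖z‖ R with hz | hz
    · simp only [pairingIntegrand, norm_mul, RCLike.norm_conj, map_one, mul_one]
      calc _ = ‖g z‖ * (‖f z‖ * ‖(Real.exp (-α * ‖z‖ ^ 2) : ℂ)‖) := by ring
        _ ≤ _ := by gcongr; exact hA z (by simpa using hz)
    · simp [pairingIntegrand, hs z hz]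

/-! ### The function representing a bounded functional -/

variable [Fact (1 < p)]

/-- The function that represents a functional: `z ↦ (α/π) \overline{φ(K_z)}`. -/
def repr (h : DualWeights α p q t C w w') (φ : StrongDual ℂ (FockSpace α p w)) (z : ℂ) : ℂ :=
  (α / Real.pi : ℝ) * conj (φ (h.kernelElem z))

/-- The Taylor coefficients of the representing function. -/
def reprCoeff (h : DualWeights α p q t C w w') (φ : StrongDual ℂ (FockSpace α p w)) (n : ℕ) : ℂ :=
  (α / Real.pi : ℝ) * (α ^ n / n.factorial) * conj (φ (h.mono n))

theorem polyFun_reprCoeff (h : DualWeights α p q t C w w') (φ : StrongDual ℂ (FockSpace α p w))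
    (N : ℕ) (z : ℂ) : polyFun (h.reprCoeff φ) N z =
      (α / Real.pi : ℝ) * conj (φ (h.polyElem (kernelCoeff α z) N)) := by
  rw [polyElem, map_sum, map_sum, polyFun, Finset.mul_sum]
  refine Finset.sum_congr rfl fun n _ => ?_
  rw [map_smul, smul_eq_mul]
  simp only [reprCoeff, kernelCoeff, map_div₀, map_pow, map_mul, Complex.conj_conj,
    Complex.conj_ofReal, map_natCast, mul_pow]
  ring

theorem norm_repr_sub_le (h : DualWeights α p q t C w w') (φ : StrongDual ℂ (FockSpace α p w))
    (N : ℕ) {R : ℝ} {z : ℂ} (hz : ‖z‖ ≤ R) : ‖h.repr φ z - polyFun (h.reprCoeff φ) N z‖ ≤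
      (1 / 2) ^ N * (α / Real.pi * ‖φ‖ * h.expNorm (2 * α * R)) := by
  have hα := h.alpha_pos
  have hπ := Real.pi_pos
  rw [h.polyFun_reprCoeff, repr, ← mul_sub, ← map_sub, ← map_sub, norm_mul, Complex.norm_real,
    Real.norm_of_nonneg (by positivity), RCLike.norm_conj]
  have h1 : ‖h.kernelElem z - h.polyElem (kernelCoeff α z) N‖ ≤
      (1 / 2) ^ N * h.expNorm (2 * α * R) := by
    refine h.norm_sub_le_of_growth _ _ (by positivity) fun y => ?_
    rw [h.polyElem_apply]
    refine (norm_kernel_sub_polyFun_le hα z y N).trans ?_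
    gcongr
  calc _ ≤ α / Real.pi * (‖φ‖ * ((1 / 2) ^ N * h.expNorm (2 * α * R))) := by
        gcongr
        exact (φ.le_opNorm _).trans (by gcongr)
    _ = _ := by ring

theorem differentiable_repr (h : DualWeights α p q t C w w')
    (φ : StrongDual ℂ (FockSpace α p w)) : Differentiable ℂ (h.repr φ) :=
  differentiable_of_approx (differentiable_polyFun (h.reprCoeff φ)) _
    fun N _ _ hz => h.norm_repr_sub_le φ N hz

/-- Formally φ is moved inside the integral defining Pf. Taylor polynomials replace that
interchange: those of Pf converge in the Fock norm, those of the representing function uniformly on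
the support of f. -/
theorem apply_projElem (h : DualWeights α p q t C w w') (φ : StrongDual ℂ (FockSpace α p w))
    {f : ℂ → ℂ} (hf : MemLp f (ENNReal.ofReal p) (fockMeasure α p w)) {R : ℝ}
    (hs : ∀ z, R < ‖z‖ → f z = 0) : φ (h.projElem hf hs) = pairing α f (h.repr φ) := by
  have hα := h.alpha_pos
  have hπ := Real.pi_pos
  set m := ∫ z, ‖pairingIntegrand α f (fun _ => 1) z‖
  have hm : 0 ≤ m := integral_nonneg fun _ => norm_nonneg _
  have h1 : Filter.Tendsto (fun N => φ (h.polyElem (projCoeff α f) N)) Filter.atTop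
      (nhds (φ (h.projElem hf hs))) := by
    refine (φ.continuous.tendsto _).comp (tendsto_iff_norm_sub_tendsto_zero.2 ?_)
    refine squeeze_zero (fun _ => norm_nonneg _) (fun N => ?_)
      (tendsto_half_pow_mul (α / Real.pi * m * h.expNorm (2 * α * R)))
    rw [norm_sub_rev]
    refine (h.norm_sub_le_of_growth _ _ (A := (1 / 2) ^ N * (α / Real.pi * m))
      (B := 2 * α * R) (by positivity) fun y => ?_).trans (le_of_eq (by ring))
    rw [h.polyElem_apply]
    exact h.norm_proj_sub_le hf hs N y
  have h2 : Filter.Tendsto (fun N => pairing α f (polyFun (h.reprCoeff φ) N)) Filter.atTop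
      (nhds (pairing α f (h.repr φ))) := by
    rw [tendsto_iff_norm_sub_tendsto_zero]
    refine squeeze_zero (fun _ => norm_nonneg _) (fun N => ?_)
      (tendsto_half_pow_mul (α / Real.pi * ‖φ‖ * h.expNorm (2 * α * R) * m))
    rw [norm_sub_rev, ← pairing_sub_right
      (h.integrable_pairingIntegrand_of_support hf hs (h.differentiable_repr φ).continuous)
      (h.integrable_pairingIntegrand hf (h.symm.memLp_polyFun _ N)), ← mul_assoc]
    exact norm_pairing_le_of_support hs (fun z hz => h.norm_repr_sub_le φ N hz)
      (h.integrable_pairingIntegrand hf h.symm.memLp_one)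
  -- At each stage both sides are the finite sum of (α/π)(α^n/n!) ⟨f, z^n⟩ φ(z^n).
  refine tendsto_nhds_unique h1 (h2.congr fun N => ?_)
  rw [pairing_polyFun _ _ fun n => h.integrable_pairingIntegrand hf (h.symm.memLp_pow n),
    polyElem, map_sum]
  refine Finset.sum_congr rfl fun n _ => ?_
  rw [map_smul, smul_eq_mul]
  simp only [projCoeff, reprCoeff, map_div₀, map_pow, map_mul, Complex.conj_conj,
    Complex.conj_ofReal, map_natCast]
  ring

/-- For compactly supported f the pairing is φ(Pf), so boundedness of P supplies the hypothesis of
the converse Hölder inequality. -/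
theorem eLpNorm_repr_le (h : DualWeights α p q t C w w') :
    ∃ K : ℝ, 0 ≤ K ∧ ∀ φ : StrongDual ℂ (FockSpace α p w),
      eLpNorm (h.repr φ) (ENNReal.ofReal q) (fockMeasure α q w') ≤
        ENNReal.ofReal (K * ‖φ‖) := by
  obtain ⟨K, hK, hk⟩ := h.eLpNorm_proj_le
  refine ⟨K.toReal, ENNReal.toReal_nonneg, fun φ => ?_⟩
  refine h.eLpNorm_le_of_continuous (h.differentiable_repr φ).continuous (by positivity)
    fun R f hf hs => ?_
  rw [← h.apply_projElem φ hf hs]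
  have h1 : ‖h.projElem hf hs‖ ≤
      K.toReal * (eLpNorm f (ENNReal.ofReal p) (fockMeasure α p w)).toReal := by
    rw [← ENNReal.toReal_mul]
    exact ENNReal.toReal_mono (ENNReal.mul_ne_top hK hf.2.ne) (hk f hf.1)
  calc _ ≤ ‖φ‖ * ‖h.projElem hf hs‖ := φ.le_opNorm _
    _ ≤ ‖φ‖ * (K.toReal * (eLpNorm f (ENNReal.ofReal p) (fockMeasure α p w)).toReal) := by
        gcongr
    _ = _ := by ring

theorem memLp_repr (h : DualWeights α p q t C w w') (φ : StrongDual ℂ (FockSpace α p w)) :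
    MemLp (h.repr φ) (ENNReal.ofReal q) (fockMeasure α q w') := by
  obtain ⟨K, _, hk⟩ := h.eLpNorm_repr_le
  exact ⟨(h.differentiable_repr φ).continuous.aestronglyMeasurable,
    (hk φ).trans_lt ENNReal.ofReal_lt_top⟩

theorem pairing_repr (h : DualWeights α p q t C w w') (φ : StrongDual ℂ (FockSpace α p w))
    (f : FockSpace α p w) : pairing α f (h.repr φ) = φ f := by
  obtain ⟨K, hK, hk⟩ := h.eLpNorm_proj_le
  have hf := f.memLp
  have hg := h.memLp_repr φ
  set F : ℕ → ℂ → ℂ := fun n => (Metric.closedBall (0 : ℂ) n).indicator f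
  set E : ℕ → ℂ → ℂ := fun n => (Metric.closedBall (0 : ℂ) n)ᶜ.indicator f
  have hF : ∀ n, MemLp (F n) (ENNReal.ofReal p) (fockMeasure α p w) := fun n =>
    hf.indicator measurableSet_closedBall
  have hE : ∀ n, MemLp (E n) (ENNReal.ofReal p) (fockMeasure α p w) := fun n =>
    hf.indicator measurableSet_closedBall.compl
  have hs : ∀ (n : ℕ) z, (n : ℝ) < ‖z‖ → F n z = 0 := fun n z hz =>
    Set.indicator_of_notMem (by simpa using hz) _
  have hEF : ∀ n, E n = fun z => f z - F n z := fun n => by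
    ext z
    simp only [E, F, Set.indicator_compl, Pi.sub_apply]
  have ht := h.tendsto_eLpNorm_indicator_compl hf
  change Filter.Tendsto (fun n => (eLpNorm (E n) (ENNReal.ofReal p)
    (fockMeasure α p w)).toReal) Filter.atTop (nhds 0) at ht
  have h1 : Filter.Tendsto (fun n => pairing α (F n) (h.repr φ)) Filter.atTop
      (nhds (pairing α f (h.repr φ))) := by
    rw [tendsto_iff_norm_sub_tendsto_zero]
    have ht' := ht.mul_const (eLpNorm (h.repr φ) (ENNReal.ofReal q) (fockMeasure α q w')).toReal
    rw [zero_mul] at ht'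
    refine squeeze_zero (fun _ => norm_nonneg _) (fun n => ?_) ht'
    rw [norm_sub_rev, ← pairing_sub_left (h.integrable_pairingIntegrand hf hg)
      (h.integrable_pairingIntegrand (hF n) hg), ← hEF]
    exact h.norm_pairing_le (hE n) hg
  -- Since Pf = f, the difference f - P F_n is P E_n, whose norm is at most a constant times that of
  -- the tail E_n.
  have h2 : Filter.Tendsto (fun n => φ (h.projElem (hF n) (hs n))) Filter.atTop
      (nhds (φ f)) := by
    refine (φ.continuous.tendsto _).comp (tendsto_iff_norm_sub_tendsto_zero.2 ?_)
    have ht' := ht.const_mul K.toReal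
    rw [mul_zero] at ht'
    refine squeeze_zero (fun _ => norm_nonneg _) (fun n => ?_) ht'
    rw [norm_sub_rev, ← ENNReal.toReal_mul, FockSpace.norm_eq]
    refine ENNReal.toReal_mono (ENNReal.mul_ne_top hK (hE n).2.ne) ?_
    refine le_trans (le_of_eq ?_) (hk (E n) (hE n).1)
    congr 1
    ext z
    change f z - proj α (F n) z = _
    rw [← h.proj_eq_self f.differentiable hf z, proj, proj, ← mul_sub, ← pairing_sub_left
      (h.integrable_pairingIntegrand hf (h.symm.memLp_kernel z))
      (h.integrable_pairingIntegrand (hF n) (h.symm.memLp_kernel z)), ← hEF, proj]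
  simp only [h.apply_projElem] at h2
  exact tendsto_nhds_unique h1 h2

/-! ### The duality isomorphism -/

variable [Fact (1 < q)]

/-- The functional `⟨·, g⟩_α`. -/
def pairingDual (h : DualWeights α p q t C w w') (g : FockSpace α q w') :
    StrongDual ℂ (FockSpace α p w) :=
  LinearMap.mkContinuous
    { toFun := fun f => pairing α f g
      map_add' := fun f₁ f₂ => pairing_add_left (h.integrable_pairingIntegrand f₁.memLp g.memLp)
        (h.integrable_pairingIntegrand f₂.memLp g.memLp)
      map_smul' := fun c f => pairing_const_mul_left α c f g } ‖g‖
    fun f => (h.norm_pairing_le f.memLp g.memLp).trans (le_of_eq (mul_comm _ _))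

theorem pairingDual_apply (h : DualWeights α p q t C w w') (g : FockSpace α q w')
    (f : FockSpace α p w) : h.pairingDual g f = pairing α f g := rfl

theorem norm_pairingDual_le (h : DualWeights α p q t C w w') (g : FockSpace α q w') :
    ‖h.pairingDual g‖ ≤ ‖g‖ :=
  ContinuousLinearMap.opNorm_le_bound _ (norm_nonneg g) fun f =>
    (h.norm_pairing_le f.memLp g.memLp).trans (le_of_eq (mul_comm _ _))

/-- Conjugate symmetry turns (α/π) \overline{⟨K_z, g⟩} into Pg(z), and P fixes entire functions of
the dual space. -/
theorem repr_pairingDual (h : DualWeights α p q t C w w') (g : FockSpace α q w') (z : ℂ) :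
    h.repr (h.pairingDual g) z = g z := by
  rw [repr, pairingDual_apply, pairing_conj_symm]
  exact h.symm.proj_eq_self g.differentiable g.memLp z

/-- The duality as a conjugate-linear equivalence. -/
def dualLinearEquiv (h : DualWeights α p q t C w w') :
    FockSpace α q w' ≃ₛₗ[starRingEnd ℂ] StrongDual ℂ (FockSpace α p w) where
  toFun := h.pairingDual
  map_add' g₁ g₂ := by
    ext f
    exact pairing_add_right (h.integrable_pairingIntegrand f.memLp g₁.memLp)
      (h.integrable_pairingIntegrand f.memLp g₂.memLp)
  map_smul' c g := by
    ext f
    exact pairing_const_mul_right α c f g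
  invFun φ := .ofMemLp (h.repr φ) (h.differentiable_repr φ) (h.memLp_repr φ)
  left_inv g := FockSpace.ext fun z => h.repr_pairingDual g z
  right_inv φ := by
    ext f
    exact h.pairing_repr φ f

/-- The duality as a conjugate-linear homeomorphism. -/
def dualEquiv (h : DualWeights α p q t C w w') :
    FockSpace α q w' ≃SL[starRingEnd ℂ] StrongDual ℂ (FockSpace α p w) where
  toLinearEquiv := h.dualLinearEquiv
  continuous_toFun := AddMonoidHomClass.continuous_of_bound h.dualLinearEquiv 1 fun g => by
    rw [one_mul]
    exact h.norm_pairingDual_le g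
  continuous_invFun := by
    obtain ⟨K, hK, hk⟩ := h.eLpNorm_repr_le
    refine AddMonoidHomClass.continuous_of_bound h.dualLinearEquiv.symm K fun φ => ?_
    rw [← ENNReal.toReal_ofReal (by positivity : 0 ≤ K * ‖φ‖)]
    exact ENNReal.toReal_mono ENNReal.ofReal_ne_top (hk φ)

end DualWeights

end WeightedFock

end

theorem mainTheorem11 (α p p' : ℝ) [Fact (1 < p)] [Fact (1 < p')] (hα : 0 < α)
    (hpp' : p.HolderConjugate p') (w w' : ℂ → ℝ) (hw : WeightedFock.MemApRestricted p w)
    (hw' : ∀ z, w' z = w z ^ (-(p' / p))) :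
    (∀ (f : WeightedFock.FockSpace α p w) (g : WeightedFock.FockSpace α p' w'),
      MeasureTheory.Integrable (WeightedFock.pairingIntegrand α f g) MeasureTheory.volume) ∧
    ∃ Φ : WeightedFock.FockSpace α p' w' ≃SL[starRingEnd ℂ]
        StrongDual ℂ (WeightedFock.FockSpace α p w),
      ∀ (g : WeightedFock.FockSpace α p' w') (f : WeightedFock.FockSpace α p w),
        Φ g f = WeightedFock.pairing α f g := by
  obtain ⟨t, C, h⟩ := WeightedFock.dualWeights_of_memApRestricted hα hpp' hw hw'
  exact ⟨fun f g => h.integrable_pairingIntegrand f.memLp g.memLp, h.dualEquiv, fun _ _ => rfl⟩
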